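/- Let $\mathbb F_q$ be a finite field of characteristic $2$, let $a,b\in\mathbb F_q$ with $a\ne 0$, and let $E$ be the elliptic curve $y^2+y=x+\frac1{ax+b}$ over $\mathbb F_q$, with $O$ the point over $x=\infty$. Let $T\subseteq\mathbb F_q$ be a finite set of $x$-coordinates of $\mathbb F_q$-rational points of $E$ with finite coordinates (so $a\alpha+b\neq0$ for $\alpha\in T$), and let $P_i=(\alpha_i,\beta_i)$, $1\le i\le n$, be all the rational points with $x$-coordinate in $T$, listed without repetition; write $n=2s$ and $D=P_1+\dots+P_n$. Put $t=\prod_{\alpha\in T}(x-\alpha)$, $\omega=dx/t$ and $\gamma_i=\mathrm{res}_{P_i}(\omega)$. Let $3\le k\le n-2$ and $\eta\in\mathbb F_q^*$. The twisted elliptic curve code $\mathcal C(D,kO,\ell,\eta)$ is the set of all vectors $(g(P_1),\dots,g(P_n))$, where $g$ runs over the functions $$\sum_{i=0}^{(k-1)/2}a_ix^i+\sum_{j=0}^{(k-3)/2}b_jx^j(ax+b)y+b_\ell\,\eta\, x^{(k+1)/2}\quad(k\text{ odd},\ 0\le\ell\le\tfrac{k-3}2),$$ $$\sum_{i=0}^{k/2}a_ix^i+\sum_{j=0}^{(k-4)/2}b_jx^j(ax+b)y+a_\ell\,\eta\,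 x^{(k-2)/2}(ax+b)y\quad(k\text{ even},\ 0\le\ell\le\tfrac k2)$$ with $a_i,b_j\in\mathbb F_q$. A parity-check matrix of a code is a matrix whose rows form a basis of its Euclidean dual. For $M\ge1$ let $G(D,\omega,(ax+b)+MO)$ be the matrix with the rows $\big(\frac{\gamma_m\alpha_m^i}{a\alpha_m+b}\big)_{m=1}^n$, $0\le i\le\lfloor M/2\rfloor$, followed by the rows $(\gamma_m\beta_m\alpha_m^j)_{m=1}^n$, $0\le j\le\lfloor (M-3)/2\rfloor$. Put $$A_e=\sum_{m=1}^n\frac{\gamma_m}{a\alpha_m+b}\alpha_m^e,\qquad B_e=\sum_{m=1}^n\gamma_m\alpha_m^e\beta_m,\qquad C_e=\sum_{m=1}^n\gamma_m(a\alpha_m+b)\alpha_m^e\beta_m^2 .$$ Then $A_e=0$ for all $e\ge0$ and $B_{s-1}\ne0$, and the following hold. 1. Let $k$ be odd, $0\le\ell\le\frac{k-3}2$ and $N=\frac{k-3}2-\ell$. Define $a_0,\dots,a_N,b_0,\dots,b_N\in\mathbb F_q$ by $a_0=1$, for $r=1,\dots,N$ $$b_{r-1}=-\frac{\sum_{i=0}^{r-1}a_iA_{s+r-i}+\sum_{j=0}^{r-2}b_jB_{s+r-2-j}}{B_{s-1}},\qquad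 a_r=-\frac{\sum_{i=0}^{r-1}a_iB_{s+r-1-i}+\sum_{j=0}^{r-1}b_jC_{s+r-3-j}}{B_{s-1}},$$ $$b_N=-\frac{B_{s-1}+\eta\sum_{i=0}^{N}a_iA_{s-\ell-1+\frac{k+1}2-i}+\eta\sum_{j=0}^{N-1}b_jB_{s-\ell-3+\frac{k+1}2-j}}{\eta B_{s-1}} .$$ With $f(x,y)=\sum_{i=0}^Na_ix^{s-\ell-1-i}+\sum_{j=0}^Nb_jx^{s-\ell-3-j}(ax+b)y$, the row $\big(\frac{\gamma_m}{a\alpha_m+b}f(\alpha_m,\beta_m)\big)_{m=1}^n$ placed on top of $G(D,\omega,(ax+b)+(n-k-1)O)$ gives a parity-check matrix of $\mathcal C(D,kO,\ell,\eta)$. 2. Let $k$ be even, $0\le\ell\le\frac k2$ and $N=\frac k2-\ell$. Define $e_0,\dots,e_N,h_0,\dots,h_N\in\mathbb F_q$ by $h_0=1$, for $r=1,\dots,N$ $$e_{r-1}=-\frac{\sum_{i=0}^{r-2}e_iB_{s+r-2-i}+\sum_{j=0}^{r-1}h_jC_{s+r-3-j}}{B_{s-1}},\qquad h_r=-\frac{\sum_{i=0}^{r-1}e_iA_{s+r-i}+\sum_{j=0}^{r-1}h_jB_{s+r-1-j}}{B_{s-1}},$$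 $$e_N=-\frac{B_{s-1}+\eta\sum_{i=0}^{N-1}e_iB_{s-\ell+\frac{k-2}2-i}+\eta\sum_{j=0}^{N}h_jC_{s-\ell-1+\frac{k-2}2-j}}{\eta B_{s-1}} .$$ With $f(x,y)=\sum_{j=0}^Nh_jx^{s-\ell-1-j}(ax+b)y+\sum_{i=0}^Ne_ix^{s-\ell-i}$, the row $\big(\frac{\gamma_m}{a\alpha_m+b}f(\alpha_m,\beta_m)\big)_{m=1}^n$ placed on top of $G(D,\omega,(ax+b)+(n-k-1)O)$ gives a parity-check matrix of $\mathcal C(D,kO,\ell,\eta)$. -/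

import Mathlib

open Polynomial

noncomputable section

namespace TECC

variable {K : Type*} [Field K]

/-! ### The curve, its function field, rational points, expansions and residues -/

/-- The rational function `x + 1 / (a x + b)`. -/
def curveRhs (a b : K) : RatFunc K :=
  RatFunc.X + 1 / (RatFunc.C a * RatFunc.X + RatFunc.C b)

/-- The polynomial `Y ^ 2 + Y - (x + 1 / (a x + b))` over the rational function field `K(x)`. -/
def curvePoly (a b : K) : (RatFunc K)[X] :=
  Polynomial.X ^ 2 + Polynomial.X - Polynomial.C (curveRhs a b)

/-- The function field `F = K(x, y)` with `y ^ 2 + y = x + 1 / (a x + b)`. -/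
abbrev FunField (a b : K) : Type _ := AdjoinRoot (curvePoly a b)

/-- The function `x` of the curve. -/
def xF (a b : K) : FunField a b := algebraMap (RatFunc K) (FunField a b) RatFunc.X

/-- The function `y` of the curve. -/
def yF (a b : K) : FunField a b := AdjoinRoot.root (curvePoly a b)

/-- The function `a x + b` of the curve. -/
def wF (a b : K) : FunField a b :=
  algebraMap K (FunField a b) a * xF a b + algebraMap K (FunField a b) b

/-- The `K`-rational points of the curve `y ^ 2 + y = x + 1 / (a x + b)` that have finite
coordinates `(x, y)`; these are all the rational points except the two that lie over the pole
of `x` and over the zero of `a x + b`. -/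
@[ext]
structure Pt (a b : K) where
  x : K
  y : K
  ne_zero : a * x + b ≠ 0
  on_curve : y ^ 2 + y = x + 1 / (a * x + b)

/-- The coefficients of the power series `Y` with constant term `β` and `Y ^ 2 + Y = g`, in
characteristic two. -/
def yCoeff (g : PowerSeries K) (β : K) : ℕ → K
  | 0 => β
  | n + 1 => PowerSeries.coeff (n + 1) g -
      ∑ i : Fin n, yCoeff g β (i.val + 1) * yCoeff g β (n - i.val)
termination_by n => n
decreasing_by all_goals omega

/-- The power series `Y` with constant term `β` and `Y ^ 2 + Y = g`. -/
def ySeries (g : PowerSeries K) (β : K) : PowerSeries K := PowerSeries.mk (yCoeff g β)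

theorem ySeries_eq [CharP K 2] (g : PowerSeries K) (β : K)
    (h : β ^ 2 + β = PowerSeries.constantCoeff g) :
    ySeries g β ^ 2 + ySeries g β = g := by
  ext n
  rw [map_add, pow_two, PowerSeries.coeff_mul]
  simp only [ySeries, PowerSeries.coeff_mk]
  cases n with
  | zero =>
    simp only [Finset.Nat.antidiagonal_zero, Finset.sum_singleton,
      PowerSeries.coeff_zero_eq_constantCoeff]
    rw [yCoeff, ← h]
    ring
  | succ n =>
    rw [Finset.Nat.sum_antidiagonal_eq_sum_range_succ (fun i j => yCoeff g β i * yCoeff g β j),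
      Finset.sum_range_succ, Finset.sum_range_succ']
    have h2 : (2 : K) = 0 := CharTwo.two_eq_zero
    have e : ∑ i ∈ Finset.range n, yCoeff g β (i + 1) * yCoeff g β (n + 1 - (i + 1)) =
        ∑ i : Fin n, yCoeff g β (i.val + 1) * yCoeff g β (n - i.val) := by
      rw [Finset.sum_range]
      simp
    have e2 : yCoeff g β (n + 1) = PowerSeries.coeff (n + 1) g -
      ∑ i : Fin n, yCoeff g β (i.val + 1) * yCoeff g β (n - i.val) := by rw [yCoeff]
    rw [e]
    simp only [Nat.sub_zero, Nat.sub_self]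
    linear_combination e2 + h2 * yCoeff g β (n + 1) * yCoeff g β 0

/-- The Laurent expansion of a rational function at `x = α`, in powers of `τ = x - α`. -/
def expandBase (α : K) : RatFunc K →+* LaurentSeries K :=
  (RatFunc.liftRingHom
    ((HahnSeries.ofPowerSeries ℤ K).comp Polynomial.coeToPowerSeries.ringHom)
    (nonZeroDivisors_le_comap_nonZeroDivisors_of_injective _
      (HahnSeries.ofPowerSeries_injective.comp (Polynomial.coe_injective K)))).comp
    (RatFunc.laurent α : RatFunc K →+* RatFunc K)

theorem expandBase_algebraMap (α : K) (p : K[X]) :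
    expandBase α (algebraMap K[X] (RatFunc K) p) =
      HahnSeries.ofPowerSeries ℤ K (taylor α p : K[X]) := by
  simp [expandBase, RatFunc.liftRingHom_apply]

/-- The expansion of `x + 1 / (a x + b)` in powers of `τ = x - α`. -/
def rhsSeries (a b α : K) : PowerSeries K :=
  PowerSeries.C α + PowerSeries.X +
    (PowerSeries.C (a * α + b) + PowerSeries.C a * PowerSeries.X)⁻¹

theorem constantCoeff_rhsSeries (a b α : K) :
    PowerSeries.constantCoeff (rhsSeries a b α) = α + 1 / (a * α + b) := by
  simp [rhsSeries]

theorem expandBase_curveRhs (a b α : K) (h : a * α + b ≠ 0) :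
    expandBase α (curveRhs a b) = HahnSeries.ofPowerSeries ℤ K (rhsSeries a b α) := by
  have h1 : (PowerSeries.C (a * α + b) + PowerSeries.C a * PowerSeries.X) *
      (PowerSeries.C (a * α + b) + PowerSeries.C a * PowerSeries.X)⁻¹ = (1 : PowerSeries K) :=
    PowerSeries.mul_inv_cancel _ (by simpa using h)
  have h2 := congrArg (HahnSeries.ofPowerSeries ℤ K) h1
  rw [map_mul, map_one] at h2
  have hX : expandBase α (RatFunc.X : RatFunc K) =
      HahnSeries.ofPowerSeries ℤ K (PowerSeries.X + PowerSeries.C α) := by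
    rw [← RatFunc.algebraMap_X, expandBase_algebraMap]
    simp
  have hC : ∀ c : K, expandBase α (RatFunc.C c : RatFunc K) =
      HahnSeries.ofPowerSeries ℤ K (PowerSeries.C c) := by
    intro c
    rw [← RatFunc.algebraMap_C, expandBase_algebraMap]
    simp
  have h3 : expandBase α (RatFunc.C a * RatFunc.X + RatFunc.C b : RatFunc K) =
      HahnSeries.ofPowerSeries ℤ K
        (PowerSeries.C (a * α + b) + PowerSeries.C a * PowerSeries.X) := by
    rw [map_add, map_mul, hX, hC, hC, ← map_mul, ← map_add]
    congr 1
    simp only [map_add, map_mul]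
    ring
  rw [curveRhs, map_add, map_div₀, map_one, h3, hX, one_div, ← eq_inv_of_mul_eq_one_right h2,
    ← map_add, rhsSeries, add_comm (PowerSeries.C α)]

theorem expand_root [CharP K 2] {a b : K} (P : Pt a b) :
    (curvePoly a b).eval₂ (expandBase P.x)
      (HahnSeries.ofPowerSeries ℤ K (ySeries (rhsSeries a b P.x) P.y)) = 0 := by
  have h := ySeries_eq (rhsSeries a b P.x) P.y
    (by rw [constantCoeff_rhsSeries]; exact P.on_curve)
  have h' := congrArg (HahnSeries.ofPowerSeries ℤ K) h
  simp only [curvePoly, eval₂_sub, eval₂_add, eval₂_pow, eval₂_X, eval₂_C]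
  rw [expandBase_curveRhs a b P.x P.ne_zero, ← h']
  simp

/-- The expansion of a function of the curve at the rational point `P = (α, β)` in powers of the
local uniformizer `τ = x - α`: it sends `x` to `α + τ` and `y` to the unique power series in `τ`
with constant term `β` that satisfies the equation of the curve. -/
def expand [CharP K 2] {a b : K} (P : Pt a b) : FunField a b →+* LaurentSeries K :=
  AdjoinRoot.lift (expandBase P.x)
    (HahnSeries.ofPowerSeries ℤ K (ySeries (rhsSeries a b P.x) P.y)) (expand_root P)

theorem expand_algebraMap [CharP K 2] {a b : K} (P : Pt a b) (c : K) :
    expand P (algebraMap K (FunField a b) c) = HahnSeries.C c := by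
  rw [IsScalarTower.algebraMap_apply K (RatFunc K) (FunField a b), AdjoinRoot.algebraMap_eq,
    expand, AdjoinRoot.lift_of, RatFunc.algebraMap_eq_C, ← RatFunc.algebraMap_C,
    expandBase_algebraMap]
  simp

/-- The value `f(P)` at `P` of a function `f` of the curve that is regular at `P`: the constant
term of its expansion at `P`. -/
def evalAt [CharP K 2] {a b : K} (P : Pt a b) : FunField a b →ₗ[K] K where
  toFun f := (expand P f).coeff 0
  map_add' f g := by simp
  map_smul' c f := by
    rw [Algebra.smul_def, map_mul, expand_algebraMap]
    simp

/-- The residue at `P` of the differential `u dx`: since `dx = dτ` for the local uniformizer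
`τ = x - α` at `P = (α, β)`, it is the coefficient of `τ ^ (-1)` in the expansion of `u`. -/
def residue [CharP K 2] {a b : K} (P : Pt a b) (u : FunField a b) : K :=
  (expand P u).coeff (-1)

/-- The function `1 / t`, where `t = ∏_{α ∈ T} (x - α)`, so that `ω = dx / t` is the differential
`u dx` with `u` this function. -/
def invT (a b : K) (T : Finset K) : FunField a b :=
  algebraMap (RatFunc K) (FunField a b) (∏ α ∈ T, (RatFunc.X - RatFunc.C α))⁻¹

/-! ### Linear codes -/

/-- The dual code with respect to the Euclidean inner product. -/
def dualCode {n : ℕ} (C : Submodule K (Fin n → K)) : Submodule K (Fin n → K) where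
  carrier := {v | ∀ c ∈ C, ∑ i, c i * v i = 0}
  zero_mem' := by intro c _; simp
  add_mem' := by
    intro v w hv hw c hc
    simp only [Pi.add_apply, mul_add, Finset.sum_add_distrib]
    rw [hv c hc, hw c hc, add_zero]
  smul_mem' := by
    intro r v hv c hc
    simp only [Pi.smul_apply, smul_eq_mul, mul_left_comm _ r, ← Finset.mul_sum]
    rw [hv c hc, mul_zero]

/-- `H` is a parity-check matrix of `C`: its rows form a basis of the dual code of `C`. -/
def IsParityCheckMatrix {n : ℕ} {ι : Type*} (H : Matrix ι (Fin n) K)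
    (C : Submodule K (Fin n → K)) : Prop :=
  LinearIndependent K H.row ∧ Submodule.span K (Set.range H.row) = dualCode C

/-! ### The twisted codes -/

/-- The defining set for odd `k`. -/
def oddSpace (a b : K) (k l : ℕ) (η : K) : Submodule K (FunField a b) where
  carrier := {f | ∃ A B : ℕ → K,
    f = ∑ i ∈ Finset.range ((k - 1) / 2 + 1), A i • xF a b ^ i
      + ∑ j ∈ Finset.range ((k - 3) / 2 + 1), B j • (xF a b ^ j * wF a b * yF a b)
      + (B l * η) • xF a b ^ ((k + 1) / 2)}
  zero_mem' := ⟨0, 0, by simp⟩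
  add_mem' := by
    rintro _ _ ⟨A, B, rfl⟩ ⟨A', B', rfl⟩
    refine ⟨A + A', B + B', ?_⟩
    simp only [Pi.add_apply, add_smul, Finset.sum_add_distrib, add_mul]
    abel
  smul_mem' := by
    rintro c _ ⟨A, B, rfl⟩
    refine ⟨c • A, c • B, ?_⟩
    simp only [Pi.smul_apply, smul_eq_mul, mul_smul, smul_add, Finset.smul_sum]

/-- The defining set for even `k`. -/
def evenSpace (a b : K) (k l : ℕ) (η : K) : Submodule K (FunField a b) where
  carrier := {f | ∃ A B : ℕ → K,
    f = ∑ i ∈ Finset.range (k / 2 + 1), A i • xF a b ^ i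
      + ∑ j ∈ Finset.range ((k - 4) / 2 + 1), B j • (xF a b ^ j * wF a b * yF a b)
      + (A l * η) • (xF a b ^ ((k - 2) / 2) * wF a b * yF a b)}
  zero_mem' := ⟨0, 0, by simp⟩
  add_mem' := by
    rintro _ _ ⟨A, B, rfl⟩ ⟨A', B', rfl⟩
    refine ⟨A + A', B + B', ?_⟩
    simp only [Pi.add_apply, add_smul, Finset.sum_add_distrib, add_mul]
    abel
  smul_mem' := by
    rintro c _ ⟨A, B, rfl⟩
    refine ⟨c • A, c • B, ?_⟩
    simp only [Pi.smul_apply, smul_eq_mul, mul_smul, smul_add, Finset.smul_sum]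

/-- The evaluation map `f ↦ (f(P_1), …, f(P_n))`. -/
def ev [CharP K 2] {a b : K} {n : ℕ} (P : Fin n → Pt a b) : FunField a b →ₗ[K] (Fin n → K) :=
  LinearMap.pi fun i => evalAt (P i)

/-- The twisted elliptic curve code `C(D, kO, ℓ, η)` for odd `k`. -/
def oddCode [CharP K 2] {a b : K} {n : ℕ} (P : Fin n → Pt a b) (k l : ℕ) (η : K) :
    Submodule K (Fin n → K) :=
  (oddSpace a b k l η).map (ev P)

/-- The twisted elliptic curve code `C(D, kO, ℓ, η)` for even `k`. -/
def evenCode [CharP K 2] {a b : K} {n : ℕ} (P : Fin n → Pt a b) (k l : ℕ) (η : K) :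
    Submodule K (Fin n → K) :=
  (evenSpace a b k l η).map (ev P)

/-! ### The matrices -/

section Matrices

variable {a b : K} {n : ℕ} (P : Fin n → Pt a b) (γ : Fin n → K)

/-- The matrix `G(D, ω, (a x + b) + M O)` for `M ≥ 1`, with the `⌊M / 2⌋ + 1` rows
`γ_m α_m ^ i / (a α_m + b)`, `0 ≤ i ≤ ⌊M / 2⌋`, followed by the `⌊(M - 3) / 2⌋ + 1 = ⌊(M - 1) / 2⌋`
rows `γ_m β_m α_m ^ j`, `0 ≤ j ≤ ⌊(M - 3) / 2⌋`. -/
def matG (M : ℕ) : Matrix (Fin (M / 2 + 1) ⊕ Fin ((M - 1) / 2)) (Fin n) K :=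
  Matrix.fromRows
    (Matrix.of fun i m => γ m * (P m).x ^ (i : ℕ) / (a * (P m).x + b))
    (Matrix.of fun j m => γ m * (P m).y * (P m).x ^ (j : ℕ))

/-- The matrix `G(D, ω, (a x + b) + M O)` with the row `γ_m / (a α_m + b) * f(α_m, β_m)` put on
top of it. -/
def matH (f : K → K → K) (M : ℕ) :
    Matrix (Unit ⊕ (Fin (M / 2 + 1) ⊕ Fin ((M - 1) / 2))) (Fin n) K :=
  Matrix.fromRows
    (Matrix.of fun _ m => γ m / (a * (P m).x + b) * f (P m).x (P m).y)
    (matG P γ M)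

/-- `∑_m γ_m α_m ^ e / (a α_m + b)`. -/
def sumA (e : ℕ) : K := ∑ m, γ m / (a * (P m).x + b) * (P m).x ^ e

/-- `∑_m γ_m α_m ^ e β_m`. -/
def sumB (e : ℕ) : K := ∑ m, γ m * (P m).x ^ e * (P m).y

/-- `∑_m γ_m (a α_m + b) α_m ^ e β_m ^ 2`. -/
def sumC (e : ℕ) : K := ∑ m, γ m * (a * (P m).x + b) * (P m).x ^ e * (P m).y ^ 2

/-- The recursion for the coefficients `c_0, …, c_N` and `d_0, …, d_N` of `f` for odd `k`, where
`N = (k - 3) / 2 - ℓ`. -/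
structure OddRec (s k l : ℕ) (η : K) (c d : ℕ → K) : Prop where
  c_zero : c 0 = 1
  d_step : ∀ r, 1 ≤ r → r ≤ (k - 3) / 2 - l →
    d (r - 1) = -(∑ i ∈ Finset.range r, c i * sumA P γ (s + r - i)
      + ∑ j ∈ Finset.range (r - 1), d j * sumB P γ (s + r - 2 - j)) / sumB P γ (s - 1)
  c_step : ∀ r, 1 ≤ r → r ≤ (k - 3) / 2 - l →
    c r = -(∑ i ∈ Finset.range r, c i * sumB P γ (s + r - 1 - i)
      + ∑ j ∈ Finset.range r, d j * sumC P γ (s + r - 3 - j)) / sumB P γ (s - 1)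
  d_last : d ((k - 3) / 2 - l) =
    -(sumB P γ (s - 1)
      + η * ∑ i ∈ Finset.range ((k - 3) / 2 - l + 1), c i * sumA P γ (s - l - 1 + (k + 1) / 2 - i)
      + η * ∑ j ∈ Finset.range ((k - 3) / 2 - l), d j * sumB P γ (s - l - 3 + (k + 1) / 2 - j))
      / (η * sumB P γ (s - 1))

/-- The polynomial `f(x, y)` for odd `k`. -/
def oddF (a b : K) (s k l : ℕ) (c d : ℕ → K) (x y : K) : K :=
  ∑ i ∈ Finset.range ((k - 3) / 2 - l + 1), c i * x ^ (s - l - 1 - i)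
    + ∑ j ∈ Finset.range ((k - 3) / 2 - l + 1), d j * x ^ (s - l - 3 - j) * (a * x + b) * y

/-- The recursion for the coefficients `e_0, …, e_N` and `h_0, …, h_N` of `f` for even `k`, where
`N = k / 2 - ℓ`. -/
structure EvenRec (s k l : ℕ) (η : K) (e h : ℕ → K) : Prop where
  h_zero : h 0 = 1
  e_step : ∀ r, 1 ≤ r → r ≤ k / 2 - l →
    e (r - 1) = -(∑ i ∈ Finset.range (r - 1), e i * sumB P γ (s + r - 2 - i)
      + ∑ j ∈ Finset.range r, h j * sumC P γ (s + r - 3 - j)) / sumB P γ (s - 1)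
  h_step : ∀ r, 1 ≤ r → r ≤ k / 2 - l →
    h r = -(∑ i ∈ Finset.range r, e i * sumA P γ (s + r - i)
      + ∑ j ∈ Finset.range r, h j * sumB P γ (s + r - 1 - j)) / sumB P γ (s - 1)
  e_last : e (k / 2 - l) =
    -(sumB P γ (s - 1)
      + η * ∑ i ∈ Finset.range (k / 2 - l), e i * sumB P γ (s - l + (k - 2) / 2 - i)
      + η * ∑ j ∈ Finset.range (k / 2 - l + 1), h j * sumC P γ (s - l - 1 + (k - 2) / 2 - j))
      / (η * sumB P γ (s - 1))

/-- The polynomial `f(x, y)` for even `k`. -/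
def evenF (a b : K) (s k l : ℕ) (e h : ℕ → K) (x y : K) : K :=
  ∑ j ∈ Finset.range (k / 2 - l + 1), h j * x ^ (s - l - 1 - j) * (a * x + b) * y
    + ∑ i ∈ Finset.range (k / 2 - l + 1), e i * x ^ (s - l - i)

end Matrices

end TECC

end

noncomputable section

namespace TECC

variable {K : Type*} [Field K]

/-! ### Values and residues of explicit functions -/

/-! Write a function as `u.1 + u.2 (a x + b) y` with polynomials `u.1`, `u.2`, and put `w = a x +
b`, `s = T.card`. Over each `α ∈ T` lie exactly two points, with ordinates `y` and `y + 1`. In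
characteristic two, summing over such a pair kills `1`, while `y` and `y ^ 2` both contribute `1`.
Hence the weighted sum of a product of two functions over the points collapses to `pairing`, which
is `W(u.1 v.2 + u.2 v.1 + u.2 v.2 w)` with `W(p) = ∑_{α ∈ T} p(α) / t'(α)` (`sum_evalPair_mul`).

By Lagrange interpolation `W` reads off the coefficient of `X ^ (s - 1)` of a polynomial of degree
below `s` (`weightSum_eq_coeff`). Therefore `A_e = 0`, `B_e = W(X ^ e)`, `C_e = W(X ^ e w)`, with
`B_{s-1} = 1` and `B_e = 0` for `e < s - 1`.

The rows of `matG` are orthogonal to the code because all the degrees involved are too small for `W`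
to see. Orthogonality of the extra row is a triangular system for the coefficients of `f`, and the
recursions solve it: each untwisted generator gives one step or a trivial equation, and the twisted
generator fixes the last coefficient (`pairing_oddFamily`, `pairing_evenFamily`). Finally `k`
independent codewords and `n - k` independent dual vectors leave room for nothing else
(`isParityCheckMatrix_of_card_le`). -/

theorem expand_xF [CharP K 2] {a b : K} (P : Pt a b) :
    expand P (xF a b) = HahnSeries.ofPowerSeries ℤ K (PowerSeries.X + PowerSeries.C P.x) := by
  rw [xF, expand, AdjoinRoot.algebraMap_eq, AdjoinRoot.lift_of, ← RatFunc.algebraMap_X,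
    expandBase_algebraMap]
  simp

theorem expand_wF [CharP K 2] {a b : K} (P : Pt a b) :
    expand P (wF a b) = HahnSeries.ofPowerSeries ℤ K
      (PowerSeries.C a * (PowerSeries.X + PowerSeries.C P.x) + PowerSeries.C b) := by
  rw [wF, map_add, map_mul, expand_xF, expand_algebraMap, expand_algebraMap,
    ← HahnSeries.ofPowerSeries_C, ← HahnSeries.ofPowerSeries_C, ← map_mul, ← map_add]

theorem expand_yF [CharP K 2] {a b : K} (P : Pt a b) :
    expand P (yF a b) = HahnSeries.ofPowerSeries ℤ K (ySeries (rhsSeries a b P.x) P.y) := by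
  rw [yF, expand, AdjoinRoot.lift_root]

theorem evalAt_of_expand_eq [CharP K 2] {a b : K} {P : Pt a b} {f : FunField a b}
    {g : PowerSeries K} (h : expand P f = HahnSeries.ofPowerSeries ℤ K g) :
    evalAt P f = PowerSeries.constantCoeff g := by
  change (expand P f).coeff 0 = _
  rw [h, ← PowerSeries.coeff_zero_eq_constantCoeff_apply, ← HahnSeries.ofPowerSeries_apply_coeff
    (Γ := ℤ)]
  rfl

theorem evalAt_xF_pow [CharP K 2] {a b : K} (P : Pt a b) (i : ℕ) :
    evalAt P (xF a b ^ i) = P.x ^ i := by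
  rw [evalAt_of_expand_eq (by rw [map_pow, expand_xF, ← map_pow])]
  simp

theorem constantCoeff_ySeries (g : PowerSeries K) (β : K) :
    PowerSeries.constantCoeff (ySeries g β) = β := by
  rw [← PowerSeries.coeff_zero_eq_constantCoeff_apply, ySeries, PowerSeries.coeff_mk, yCoeff]

theorem evalAt_xF_pow_mul [CharP K 2] {a b : K} (P : Pt a b) (j : ℕ) :
    evalAt P (xF a b ^ j * wF a b * yF a b) = P.x ^ j * (a * P.x + b) * P.y := by
  rw [evalAt_of_expand_eq (by rw [map_mul, map_mul, map_pow, expand_xF, expand_wF, expand_yF,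
    ← map_pow, ← map_mul, ← map_mul])]
  simp [constantCoeff_ySeries]

/-- The pole is simple: with `t = (X - α) M` the expansion of `1 / t` is `τ⁻¹` times the inverse of
a unit series with constant term `M(α) = t'(α)`. -/
theorem residue_invT [CharP K 2] {a b : K} (P : Pt a b) {T : Finset K} (hP : P.x ∈ T) :
    residue P (invT a b T) = (eval P.x (derivative (Lagrange.nodal T id)))⁻¹ := by
  classical
  set M : K[X] := Lagrange.nodal (T.erase P.x) id with hM
  have hN : Lagrange.nodal T id = (X - C P.x) * M :=
    Lagrange.nodal_eq_mul_nodal_erase (v := id) hP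
  have hM0 : eval P.x M ≠ 0 := by
    exact Lagrange.eval_nodal_not_at_node fun i hi => (Finset.ne_of_mem_erase hi).symm
  have hT : (∏ α ∈ T, (RatFunc.X - RatFunc.C α) : RatFunc K) =
      algebraMap K[X] (RatFunc K) (Lagrange.nodal T id) := by
    simp [Lagrange.nodal, map_prod]
  set m : PowerSeries K := ((taylor P.x M : K[X]) : PowerSeries K) with hm
  have hm0 : PowerSeries.constantCoeff m = eval P.x M := by
    rw [hm, Polynomial.constantCoeff_coe, taylor_coeff_zero]
  have hmm : m * m⁻¹ = 1 := PowerSeries.mul_inv_cancel _ (by rwa [hm0])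
  have hexp : expand P (invT a b T) =
      HahnSeries.single (-1) 1 * HahnSeries.ofPowerSeries ℤ K m⁻¹ := by
    rw [invT, expand, AdjoinRoot.algebraMap_eq, AdjoinRoot.lift_of, map_inv₀, hT,
      expandBase_algebraMap, hN]
    symm
    apply eq_inv_of_mul_eq_one_right
    have : ((taylor P.x ((X - C P.x) * M) : K[X]) : PowerSeries K) = PowerSeries.X * m := by
      rw [taylor_mul, Polynomial.coe_mul, hm]
      simp
    rw [this, map_mul, HahnSeries.ofPowerSeries_X,
      mul_mul_mul_comm, HahnSeries.single_mul_single, ← map_mul, hmm, map_one]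
    simp
  have hd : eval P.x (derivative (Lagrange.nodal T id)) = eval P.x M := by
    rw [hN]
    simp
  rw [residue, hexp, hd, ← hm0]
  have := HahnSeries.coeff_single_mul_add (r := (1 : K))
    (x := HahnSeries.ofPowerSeries ℤ K m⁻¹) (a := 0) (b := (-1 : ℤ))
  rw [zero_add] at this
  rw [this, one_mul]
  have h2 := HahnSeries.ofPowerSeries_apply_coeff (Γ := ℤ) m⁻¹ 0
  rw [Nat.cast_zero] at h2
  rw [h2]
  simp

/-! ### Dual codes and parity-check matrices -/

theorem dualCode_eq_comap {n : ℕ} (C : Submodule K (Fin n → K)) :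
    dualCode C = C.dualAnnihilator.comap (dotProductEquiv K (Fin n)).toLinearMap := by
  ext v
  simp only [Submodule.mem_comap, Submodule.mem_dualAnnihilator]
  refine forall₂_congr fun c _ => ?_
  simp [dotProduct, mul_comm]

theorem finrank_add_finrank_dualCode {n : ℕ} (C : Submodule K (Fin n → K)) :
    Module.finrank K C + Module.finrank K (dualCode C) = n := by
  rw [dualCode_eq_comap, LinearEquiv.finrank_eq (LinearEquiv.ofSubmodule' _ _),
    Subspace.finrank_add_finrank_dualAnnihilator_eq, Module.finrank_fin_fun]

/-- Dimension count: the family `v` bounds the dimension of `C` from below, hence that of its dual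
from above by `n - card κ ≤ card ι`, which the rows already attain. -/
theorem isParityCheckMatrix_of_card_le {n : ℕ} {ι κ : Type*} [Fintype ι] [Fintype κ]
    {H : Matrix ι (Fin n) K} {C : Submodule K (Fin n → K)} (hH : LinearIndependent K H.row)
    (hHC : ∀ i, H.row i ∈ dualCode C) {v : κ → Fin n → K} (hv : LinearIndependent K v)
    (hvC : ∀ j, v j ∈ C) (hcard : n ≤ Fintype.card ι + Fintype.card κ) :
    IsParityCheckMatrix H C := by
  refine ⟨hH, Submodule.eq_of_le_of_finrank_le (Submodule.span_le.2 ?_) ?_⟩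
  · rintro _ ⟨i, rfl⟩
    exact hHC i
  · have h1 := finrank_span_eq_card hH
    have h2 := finrank_span_eq_card hv
    have h3 : Module.finrank K (Submodule.span K (Set.range v)) ≤ Module.finrank K C := by
      refine Submodule.finrank_mono (Submodule.span_le.2 ?_)
      rintro _ ⟨j, rfl⟩
      exact hvC j
    have h4 := finrank_add_finrank_dualCode C
    omega

/-! ### Linear recursions -/

theorem exists_linear_recursion (g : ℕ → K) (M : ℕ → ℕ → K) :
    ∃ u : ℕ → K, ∀ r, u r = g r + ∑ i ∈ Finset.range r, u i * M r i := by
  refine ⟨fun r => Nat.strongRec (motive := fun _ => K)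
    (fun r u => g r + ∑ i : Fin r, u i i.2 * M r i) r, fun r => ?_⟩
  dsimp only
  rw [Nat.strongRec_eq, Finset.sum_range]

/-! ### Weighted sums over the `x`-coordinates -/

/-- The functional `u ↦ ∑_{α ∈ T} u(α) / t'(α)` on polynomials, where `t = ∏_{α ∈ T} (X - α)`. -/
def weightSum (T : Finset K) : K[X] →ₗ[K] K :=
  ∑ α ∈ T, (eval α (derivative (Lagrange.nodal T id)))⁻¹ • leval α

theorem weightSum_apply (T : Finset K) (u : K[X]) :
    weightSum T u = ∑ α ∈ T, (eval α (derivative (Lagrange.nodal T id)))⁻¹ * eval α u := by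
  simp [weightSum]

/-- The numbers `1 / t'(α)` are the leading coefficients of the Lagrange basis polynomials on `T`.
-/
theorem weightSum_eq_coeff {T : Finset K} {u : K[X]} (hu : u.degree < T.card) :
    weightSum T u = u.coeff (T.card - 1) := by
  classical
  rw [Lagrange.coeff_eq_sum (v := id) Function.injective_id.injOn hu, weightSum_apply]
  refine Finset.sum_congr rfl fun α hα => ?_
  have h := Lagrange.nodalWeight_eq_eval_derivative_nodal (v := (id : K → K)) hα
  rw [Lagrange.nodalWeight, Finset.prod_inv_distrib] at h
  rw [div_eq_mul_inv, h, mul_comm]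
  rfl

theorem weightSum_X_pow_of_lt {T : Finset K} {e : ℕ} (he : e < T.card - 1) :
    weightSum T (X ^ e) = 0 := by
  rw [weightSum_eq_coeff (by rw [degree_X_pow]; exact_mod_cast (by omega : e < T.card)),
    coeff_X_pow, if_neg (by omega)]

theorem weightSum_X_pow_card_sub_one {T : Finset K} (hT : 0 < T.card) :
    weightSum T (X ^ (T.card - 1)) = 1 := by
  rw [weightSum_eq_coeff
    (by rw [degree_X_pow]; exact_mod_cast (by omega : T.card - 1 < T.card)), coeff_X_pow,
    if_pos rfl]

/-- The linear polynomial `a X + b`. -/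
def wPoly (a b : K) : K[X] := C a * X + C b

theorem weightSum_X_pow_mul_wPoly (a b : K) (T : Finset K) (e : ℕ) :
    weightSum T (X ^ e * wPoly a b) =
      a * weightSum T (X ^ (e + 1)) + b * weightSum T (X ^ e) := by
  have : X ^ e * wPoly a b = a • X ^ (e + 1) + b • X ^ e := by
    rw [wPoly, smul_eq_C_mul, smul_eq_C_mul]
    ring
  rw [this, map_add, map_smul, map_smul, smul_eq_mul, smul_eq_mul]

theorem weightSum_X_pow_mul_wPoly_of_lt (a b : K) {T : Finset K} {e : ℕ}
    (he : e + 1 < T.card - 1) : weightSum T (X ^ e * wPoly a b) = 0 := by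
  rw [weightSum_X_pow_mul_wPoly, weightSum_X_pow_of_lt he, weightSum_X_pow_of_lt (by omega)]
  simp

/-- The pairing that corresponds to `∑_m γ_m / (a α_m + b) * f(P_m) * g(P_m)` for the functions
`f = u.1 + u.2 (a x + b) y` and `g = v.1 + v.2 (a x + b) y`. -/
def pairing (a b : K) (T : Finset K) (u v : K[X] × K[X]) : K :=
  weightSum T (u.1 * v.2 + u.2 * v.1 + u.2 * v.2 * wPoly a b)

/-! ### Sums over pairs of conjugate points -/

/-- The points `P` are the points `(α, y α)` and `(α, y α + 1)` for `α ∈ T`, and `γ` lists the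
residues of `dx / ∏_{α ∈ T} (x - α)`. -/
structure IsConjugatePairs {a b : K} {n : ℕ} (P : Fin n → Pt a b) (γ : Fin n → K)
    (T : Finset K) (y : K → K) : Prop where
  residue_eq : ∀ m, γ m = (eval (P m).x (derivative (Lagrange.nodal T id)))⁻¹
  mem : ∀ m, (P m).x ∈ T
  exists_fst : ∀ α ∈ T, ∃ m, (P m).x = α ∧ (P m).y = y α
  exists_snd : ∀ α ∈ T, ∃ m, (P m).x = α ∧ (P m).y = y α + 1
  sum_eq : ∀ F : K → K → K,
    ∑ m, F (P m).x (P m).y = ∑ α ∈ T, (F α (y α) + F α (y α + 1))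
  card_eq : n = 2 * T.card

theorem sum_points_eq {a b : K} [CharP K 2] {T : Finset K} {n : ℕ} {P : Fin n → Pt a b}
    (hP : Function.Injective P) (hD : ∀ Q : Pt a b, (∃ i, P i = Q) ↔ Q.x ∈ T) {y : K → K}
    (hy : ∀ α ∈ T, ∃ Q : Pt a b, Q.x = α ∧ Q.y = y α)
    (hy' : ∀ α ∈ T, ∃ Q : Pt a b, Q.x = α ∧ Q.y = y α + 1)
    {M : Type*} [AddCommMonoid M] (F : K → K → M) :
    ∑ m, F (P m).x (P m).y = ∑ α ∈ T, (F α (y α) + F α (y α + 1)) := by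
  classical
  have h01 : (0 : K) ≠ 1 := zero_ne_one
  have : ∑ α ∈ T, (F α (y α) + F α (y α + 1)) =
      ∑ z ∈ T ×ˢ ({0, 1} : Finset K), F z.1 (y z.1 + z.2) := by
    rw [Finset.sum_product]
    refine Finset.sum_congr rfl fun α _ => ?_
    rw [Finset.sum_pair h01, add_zero]
  rw [this]
  -- Two solutions of the same equation `Y ^ 2 + Y = g` differ by a root of `Z (Z - 1)`, so the
  -- second coordinate lies in `{0, 1}`.
  refine Finset.sum_bij (fun m _ => ((P m).x, (P m).y - y (P m).x)) ?_ ?_ ?_ ?_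
  · intro m _
    have hm : (P m).x ∈ T := (hD _).1 ⟨m, rfl⟩
    obtain ⟨Q, hQx, hQy⟩ := hy _ hm
    have h1 := (P m).on_curve
    have h2 := Q.on_curve
    rw [hQx, hQy] at h2
    have h3 : ((P m).y - y (P m).x) * ((P m).y - y (P m).x - 1) = 0 := by
      have e : (2 : K) = 0 := CharTwo.two_eq_zero
      linear_combination h1 - h2 + e * (y (P m).x ^ 2 + y (P m).x - (P m).y
        - (P m).y * y (P m).x)
    rw [Finset.mem_product]
    refine ⟨hm, ?_⟩
    rcases mul_eq_zero.1 h3 with h | h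
    · simp [h]
    · simp [sub_eq_zero.1 h]
  · intro m _ m' _ h
    rw [Prod.mk.injEq] at h
    obtain ⟨hx, h⟩ := h
    rw [hx, sub_left_inj] at h
    exact hP (Pt.ext hx h)
  · rintro ⟨α, z⟩ hz
    rw [Finset.mem_product] at hz
    obtain ⟨hα, hz⟩ := hz
    simp only [Finset.mem_insert, Finset.mem_singleton] at hz
    have : ∃ Q : Pt a b, Q.x = α ∧ Q.y = y α + z := by
      rcases hz with rfl | rfl
      · simpa using hy α hα
      · exact hy' α hα
    obtain ⟨Q, rfl, hQy⟩ := this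
    obtain ⟨m, rfl⟩ := (hD Q).2 hα
    exact ⟨m, Finset.mem_univ _, by rw [hQy, add_sub_cancel_left]⟩
  · intro m _
    simp

theorem exists_isConjugatePairs [CharP K 2] {a b : K} {T : Finset K}
    (hT : ∀ α ∈ T, ∃ P : Pt a b, P.x = α) {n : ℕ} {P : Fin n → Pt a b}
    (hP : Function.Injective P) (hD : ∀ Q : Pt a b, (∃ i, P i = Q) ↔ Q.x ∈ T)
    {γ : Fin n → K} (hγ : ∀ i, γ i = residue (P i) (invT a b T)) :
    ∃ y : K → K, IsConjugatePairs P γ T y := by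
  have h : ∀ α, ∃ β, α ∈ T → ∃ Q : Pt a b, Q.x = α ∧ Q.y = β := fun α => by
    by_cases hα : α ∈ T
    · obtain ⟨Q, hQ⟩ := hT α hα
      exact ⟨Q.y, fun _ => ⟨Q, hQ, rfl⟩⟩
    · exact ⟨0, fun h => absurd h hα⟩
  choose y hy using h
  have hy' : ∀ α ∈ T, ∃ Q : Pt a b, Q.x = α ∧ Q.y = y α + 1 := by
    intro α hα
    obtain ⟨Q, rfl, hQy⟩ := hy α hα
    refine ⟨⟨Q.x, Q.y + 1, Q.ne_zero, ?_⟩, rfl, congrArg (· + 1) hQy⟩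
    have e : (2 : K) = 0 := CharTwo.two_eq_zero
    linear_combination Q.on_curve + e * (Q.y + 1)
  have hmem : ∀ m, (P m).x ∈ T := fun m => (hD _).1 ⟨m, rfl⟩
  refine ⟨y, fun m => by rw [hγ, residue_invT _ (hmem m)], hmem, ?_, ?_,
    fun F => sum_points_eq hP hD hy hy' F, ?_⟩
  · intro α hα
    obtain ⟨Q, rfl, hQy⟩ := hy α hα
    obtain ⟨m, rfl⟩ := (hD Q).2 hα
    exact ⟨m, rfl, hQy⟩
  · intro α hα
    obtain ⟨Q, rfl, hQy⟩ := hy' α hα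
    obtain ⟨m, rfl⟩ := (hD Q).2 hα
    exact ⟨m, rfl, hQy⟩
  · have := sum_points_eq hP hD hy hy' (fun _ _ => (1 : ℕ))
    simp only [Finset.sum_const, Finset.card_univ, Fintype.card_fin, smul_eq_mul] at this
    omega

/-- The values of the function `u.1 + u.2 (a x + b) y` at the points `P`. -/
def evalPair {a b : K} {n : ℕ} (P : Fin n → Pt a b) : K[X] × K[X] →ₗ[K] (Fin n → K) where
  toFun u m := eval (P m).x u.1 + eval (P m).x u.2 * (a * (P m).x + b) * (P m).y
  map_add' u v := by
    ext m
    simp only [Prod.fst_add, Prod.snd_add, eval_add, Pi.add_apply]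
    ring
  map_smul' c u := by
    ext m
    simp only [Prod.smul_fst, Prod.smul_snd, eval_smul, Pi.smul_apply, smul_eq_mul,
      RingHom.id_apply]
    ring

theorem evalPair_apply {a b : K} {n : ℕ} (P : Fin n → Pt a b) (u : K[X] × K[X]) (m : Fin n) :
    evalPair P u m = eval (P m).x u.1 + eval (P m).x u.2 * (a * (P m).x + b) * (P m).y := rfl

namespace IsConjugatePairs

variable {a b : K} {n : ℕ} {P : Fin n → Pt a b} {γ : Fin n → K} {T : Finset K} {y : K → K}

theorem ne_zero (h : IsConjugatePairs P γ T y) {α : K} (hα : α ∈ T) : a * α + b ≠ 0 := by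
  obtain ⟨m, rfl, -⟩ := h.exists_fst α hα
  exact (P m).ne_zero

theorem residue_ne_zero (h : IsConjugatePairs P γ T y) (m : Fin n) : γ m ≠ 0 := by
  classical
  rw [h.residue_eq]
  have := Lagrange.nodalWeight_ne_zero (v := (id : K → K)) Function.injective_id.injOn (h.mem m)
  rwa [Lagrange.nodalWeight_eq_eval_derivative_nodal (h.mem m)] at this

theorem sumA_eq_zero [CharP K 2] (h : IsConjugatePairs P γ T y) (e : ℕ) : sumA P γ e = 0 := by
  simp only [sumA, h.residue_eq]
  rw [h.sum_eq fun α _ => (eval α (derivative (Lagrange.nodal T id)))⁻¹ / (a * α + b) * α ^ e]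
  exact Finset.sum_eq_zero fun α _ => CharTwo.add_self_eq_zero _

theorem sumB_eq [CharP K 2] (h : IsConjugatePairs P γ T y) (e : ℕ) :
    sumB P γ e = weightSum T (X ^ e) := by
  simp only [sumB, h.residue_eq]
  rw [h.sum_eq fun α β => (eval α (derivative (Lagrange.nodal T id)))⁻¹ * α ^ e * β,
    weightSum_apply]
  refine Finset.sum_congr rfl fun α _ => ?_
  have e2 : (2 : K) = 0 := CharTwo.two_eq_zero
  rw [eval_pow, eval_X]
  linear_combination e2 * ((eval α (derivative (Lagrange.nodal T id)))⁻¹ * α ^ e * y α)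

theorem sumC_eq [CharP K 2] (h : IsConjugatePairs P γ T y) (e : ℕ) :
    sumC P γ e = weightSum T (X ^ e * wPoly a b) := by
  simp only [sumC, h.residue_eq]
  rw [h.sum_eq fun α β =>
    (eval α (derivative (Lagrange.nodal T id)))⁻¹ * (a * α + b) * α ^ e * β ^ 2, weightSum_apply]
  refine Finset.sum_congr rfl fun α _ => ?_
  have e2 : (2 : K) = 0 := CharTwo.two_eq_zero
  simp only [wPoly, eval_mul, eval_add, eval_C, eval_pow, eval_X]
  linear_combination e2 * ((eval α (derivative (Lagrange.nodal T id)))⁻¹ * (a * α + b) * α ^ e *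
    (y α ^ 2 + y α))

/-- A trace computation: `y + (y + 1) = 1` and `y ^ 2 + (y + 1) ^ 2 = 1`, while terms free of `y`
cancel. One factor `w` is absorbed by the denominator, so only the product `u.2 v.2` keeps a `w`. -/
theorem sum_evalPair_mul [CharP K 2] (h : IsConjugatePairs P γ T y) (u v : K[X] × K[X]) :
    ∑ m, evalPair P u m * (γ m / (a * (P m).x + b) * evalPair P v m) = pairing a b T u v := by
  simp only [evalPair_apply, h.residue_eq]
  rw [h.sum_eq fun α β => (eval α u.1 + eval α u.2 * (a * α + b) * β) *
    ((eval α (derivative (Lagrange.nodal T id)))⁻¹ / (a * α + b) *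
      (eval α v.1 + eval α v.2 * (a * α + b) * β)), pairing, weightSum_apply]
  refine Finset.sum_congr rfl fun α hα => ?_
  have e2 : (2 : K) = 0 := CharTwo.two_eq_zero
  have hw := h.ne_zero hα
  simp only [wPoly, eval_mul, eval_add, eval_C, eval_X]
  generalize eval α u.1 = p, eval α u.2 = q, eval α v.1 = p', eval α v.2 = q',
    (eval α (derivative (Lagrange.nodal T id)))⁻¹ = g
  generalize a * α + b = w at hw ⊢
  field_simp
  linear_combination e2 * g * (p * p' + (p * q' + p' * q) * w * y α +
    q * q' * w ^ 2 * (y α ^ 2 + y α))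

/-- Subtracting the values at the two points over `α` isolates `u.2(α) (a α + b)`. Thus vanishing at
all points is tested on each component separately, which the independence proofs rely on. -/
theorem eval_eq_zero (h : IsConjugatePairs P γ T y) {u : K[X] × K[X]} (hu : evalPair P u = 0)
    {α : K} (hα : α ∈ T) : eval α u.1 = 0 ∧ eval α u.2 = 0 := by
  obtain ⟨m, hm, hy⟩ := h.exists_fst α hα
  obtain ⟨m', hm', hy'⟩ := h.exists_snd α hα
  have h1 := congrFun hu m
  have h2 := congrFun hu m'
  rw [evalPair_apply, hm, hy, Pi.zero_apply] at h1
  rw [evalPair_apply, hm', hy', Pi.zero_apply] at h2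
  have h3 : eval α u.2 * (a * α + b) = 0 := by linear_combination h2 - h1
  have h4 := (mul_eq_zero.1 h3).resolve_right (h.ne_zero hα)
  rw [h4] at h1
  exact ⟨by linear_combination h1, h4⟩

theorem fst_eq_zero (h : IsConjugatePairs P γ T y) {u : K[X] × K[X]} (hu : evalPair P u = 0)
    (hd : u.1 ∈ degreeLT K T.card) : u.1 = 0 :=
  eq_zero_of_degree_lt_of_eval_finset_eq_zero T (mem_degreeLT.1 hd)
    fun _ hα => (h.eval_eq_zero hu hα).1

theorem snd_eq_zero (h : IsConjugatePairs P γ T y) {u : K[X] × K[X]} (hu : evalPair P u = 0)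
    (hd : u.2 ∈ degreeLT K T.card) : u.2 = 0 :=
  eq_zero_of_degree_lt_of_eval_finset_eq_zero T (mem_degreeLT.1 hd)
    fun _ hα => (h.eval_eq_zero hu hα).2

end IsConjugatePairs

/-! ### Linear independence -/

theorem coeff_sum_smul_X_pow {m : ℕ} (g : Fin m → K) (i : Fin m) :
    (∑ j, g j • (X : K[X]) ^ (j : ℕ)).coeff i = g i := by
  simp [finsetSum_coeff, coeff_X_pow, Fin.val_inj]

theorem coeff_sum_smul_X_pow_of_le {m d : ℕ} (g : Fin m → K) (hd : m ≤ d) :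
    (∑ j, g j • (X : K[X]) ^ (j : ℕ)).coeff d = 0 := by
  simp only [finsetSum_coeff, coeff_smul, coeff_X_pow]
  exact Finset.sum_eq_zero fun j _ => by rw [if_neg (by omega), smul_zero]

theorem eq_zero_of_sum_smul_X_pow_eq_zero {m : ℕ} {g : Fin m → K}
    (h : ∑ j, g j • (X : K[X]) ^ (j : ℕ) = 0) (i : Fin m) : g i = 0 := by
  rw [← coeff_sum_smul_X_pow g i, h, coeff_zero]

theorem X_pow_mem_degreeLT {d e : ℕ} (h : e < d) : (X : K[X]) ^ e ∈ degreeLT K d := by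
  rw [mem_degreeLT, degree_X_pow]
  exact_mod_cast h

theorem sum_smul_X_pow_mem_degreeLT {m d : ℕ} (g : Fin m → K) (h : m ≤ d) :
    ∑ j, g j • (X : K[X]) ^ (j : ℕ) ∈ degreeLT K d :=
  Submodule.sum_mem _ fun j _ => Submodule.smul_mem _ _ (X_pow_mem_degreeLT (by omega))

/-- The functions `f`, `x ^ i` for `i < m₁` and `x ^ j (a x + b) y` for `j < m₂`, as pairs of
polynomials. -/
def checkFamily (f : K[X] × K[X]) (m₁ m₂ : ℕ) :
    Unit ⊕ (Fin m₁ ⊕ Fin m₂) → K[X] × K[X] :=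
  Sum.elim (fun _ => f) (Sum.elim (fun i => (X ^ (i : ℕ), 0)) (fun j => (0, X ^ (j : ℕ))))

namespace IsConjugatePairs

variable {a b : K} {n : ℕ} {P : Fin n → Pt a b} {γ : Fin n → K} {T : Finset K} {y : K → K}

/-- The first components alone force the coefficients of the left block to vanish; the terms `r i`
then disappear, so they need no degree bound. They accommodate the twist for even `k`. -/
theorem linearIndependent_add_snd (h : IsConjugatePairs P γ T y) {m₁ m₂ : ℕ}
    (h₁ : m₁ ≤ T.card) (h₂ : m₂ ≤ T.card) (r : Fin m₁ → K[X]) :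
    LinearIndependent K (fun i => evalPair P ((Sum.elim (fun i : Fin m₁ => (X ^ (i : ℕ), r i))
      (fun j : Fin m₂ => (0, X ^ (j : ℕ))) : Fin m₁ ⊕ Fin m₂ → K[X] × K[X]) i)) := by
  rw [Fintype.linearIndependent_iff]
  intro g hg
  simp only [Fintype.sum_sum_type, Sum.elim_inl, Sum.elim_inr, ← map_smul, ← map_sum] at hg
  have hp := h.fst_eq_zero hg (by
    simpa [Prod.fst_sum] using sum_smul_X_pow_mem_degreeLT (fun i => g (Sum.inl i)) h₁)
  have hl := eq_zero_of_sum_smul_X_pow_eq_zero (g := fun i => g (Sum.inl i))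
    (by simpa [Prod.fst_sum] using hp)
  have hq := h.snd_eq_zero hg (by
    simpa [Prod.snd_sum, hl] using sum_smul_X_pow_mem_degreeLT (fun i => g (Sum.inr i)) h₂)
  have hr := eq_zero_of_sum_smul_X_pow_eq_zero (g := fun i => g (Sum.inr i))
    (by simpa [Prod.snd_sum, hl] using hq)
  exact fun i => i.casesOn hl hr

theorem linearIndependent_add_fst (h : IsConjugatePairs P γ T y) {m₁ m₂ : ℕ}
    (h₁ : m₁ ≤ T.card) (h₂ : m₂ ≤ T.card) (r : Fin m₂ → K[X]) :
    LinearIndependent K (fun i => evalPair P ((Sum.elim (fun i : Fin m₁ => (X ^ (i : ℕ), 0))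
      (fun j : Fin m₂ => (r j, X ^ (j : ℕ))) : Fin m₁ ⊕ Fin m₂ → K[X] × K[X]) i)) := by
  rw [Fintype.linearIndependent_iff]
  intro g hg
  simp only [Fintype.sum_sum_type, Sum.elim_inl, Sum.elim_inr, ← map_smul, ← map_sum] at hg
  have hq := h.snd_eq_zero hg (by
    simpa [Prod.snd_sum] using sum_smul_X_pow_mem_degreeLT (fun i => g (Sum.inr i)) h₂)
  have hr := eq_zero_of_sum_smul_X_pow_eq_zero (g := fun i => g (Sum.inr i))
    (by simpa [Prod.snd_sum] using hq)
  have hp := h.fst_eq_zero hg (by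
    simpa [Prod.fst_sum, hr] using sum_smul_X_pow_mem_degreeLT (fun i => g (Sum.inl i)) h₁)
  have hl := eq_zero_of_sum_smul_X_pow_eq_zero (g := fun i => g (Sum.inl i))
    (by simpa [Prod.fst_sum, hr] using hp)
  exact fun i => i.casesOn hl hr

theorem eq_zero_of_sum_checkFamily_eq_zero (h : IsConjugatePairs P γ T y) {f : K[X] × K[X]}
    {m₁ m₂ : ℕ} (h₁ : m₁ ≤ T.card) (h₂ : m₂ ≤ T.card) {g : Unit ⊕ (Fin m₁ ⊕ Fin m₂) → K}
    (hg : ∑ i, g i • evalPair P (checkFamily f m₁ m₂ i) = 0) (h0 : g (Sum.inl ()) = 0)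
    (i : Unit ⊕ (Fin m₁ ⊕ Fin m₂)) : g i = 0 := by
  rcases i with i | i
  · exact h0
  · have hli := Fintype.linearIndependent_iff.1
      (h.linearIndependent_add_snd h₁ h₂ (fun _ => 0)) (fun i => g (Sum.inr i))
    refine hli ?_ i
    rw [Fintype.sum_sum_type] at hg
    simpa [h0, checkFamily] using hg

/-- The monomials `X ^ i` with `i < m₁ ≤ d` cannot cancel the coefficient of `X ^ d` in `f.1`, so
`f` enters no relation. Only the first component of `f` needs a degree bound. -/
theorem linearIndependent_checkFamily_of_fst (h : IsConjugatePairs P γ T y) {f : K[X] × K[X]}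
    {m₁ m₂ d : ℕ} (hf : f.1 ∈ degreeLT K T.card) (hd : f.1.coeff d ≠ 0) (h₁ : m₁ ≤ d)
    (h₁' : m₁ ≤ T.card) (h₂ : m₂ ≤ T.card) :
    LinearIndependent K (fun i => evalPair P (checkFamily f m₁ m₂ i)) := by
  rw [Fintype.linearIndependent_iff]
  intro g hg
  refine h.eq_zero_of_sum_checkFamily_eq_zero h₁' h₂ hg ?_
  simp only [checkFamily, Fintype.sum_sum_type, Sum.elim_inl, Sum.elim_inr, ← map_smul, ← map_sum] at hg
  have hp := h.fst_eq_zero hg (by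
    simpa [Prod.fst_sum] using Submodule.add_mem _ (Submodule.smul_mem _ (g (Sum.inl ())) hf)
      (sum_smul_X_pow_mem_degreeLT (fun i => g (Sum.inr (Sum.inl i))) h₁'))
  have := congrArg (coeff · d) hp
  have hz := coeff_sum_smul_X_pow_of_le (fun i => g (Sum.inr (Sum.inl i))) h₁
  simp only [Prod.fst_add, Prod.fst_sum, Prod.smul_fst, smul_zero, Finset.sum_const_zero,
    coeff_add, hz, add_zero, coeff_zero, Finset.univ_unique, Finset.sum_singleton, coeff_smul,
    smul_eq_mul] at this
  exact (mul_eq_zero.1 this).resolve_right hd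

theorem linearIndependent_checkFamily_of_snd (h : IsConjugatePairs P γ T y) {f : K[X] × K[X]}
    {m₁ m₂ d : ℕ} (hf : f.2 ∈ degreeLT K T.card) (hd : f.2.coeff d ≠ 0) (h₂ : m₂ ≤ d)
    (h₁ : m₁ ≤ T.card) (h₂' : m₂ ≤ T.card) :
    LinearIndependent K (fun i => evalPair P (checkFamily f m₁ m₂ i)) := by
  rw [Fintype.linearIndependent_iff]
  intro g hg
  refine h.eq_zero_of_sum_checkFamily_eq_zero h₁ h₂' hg ?_
  simp only [checkFamily, Fintype.sum_sum_type, Sum.elim_inl, Sum.elim_inr, ← map_smul, ← map_sum] at hg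
  have hp := h.snd_eq_zero hg (by
    simpa [Prod.snd_sum] using Submodule.add_mem _ (Submodule.smul_mem _ (g (Sum.inl ())) hf)
      (sum_smul_X_pow_mem_degreeLT (fun i => g (Sum.inr (Sum.inr i))) h₂'))
  have := congrArg (coeff · d) hp
  have hz := coeff_sum_smul_X_pow_of_le (fun i => g (Sum.inr (Sum.inr i))) h₂
  simp only [Prod.snd_add, Prod.snd_sum, Prod.smul_snd, smul_zero, Finset.sum_const_zero,
    coeff_add, hz, add_zero, zero_add, coeff_zero, Finset.univ_unique, Finset.sum_singleton,
    coeff_smul, smul_eq_mul] at this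
  exact (mul_eq_zero.1 this).resolve_right hd

/-- A criterion for `matH` to be a parity-check matrix, in terms of pairs of polynomials. -/
theorem isParityCheckMatrix_matH [CharP K 2] (h : IsConjugatePairs P γ T y)
    {F : K → K → K} {f : K[X] × K[X]} (hF : ∀ m, F (P m).x (P m).y = evalPair P f m) {M : ℕ}
    {C : Submodule K (Fin n → K)} {κ : Type*} [Fintype κ] {v : κ → K[X] × K[X]}
    (hf : LinearIndependent K (fun i => evalPair P (checkFamily f (M / 2 + 1) ((M - 1) / 2) i)))
    (hv : LinearIndependent K (fun i => evalPair P (v i)))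
    (hC : C = Submodule.span K (Set.range fun i => evalPair P (v i)))
    (hp : ∀ i j, pairing a b T (v j) (checkFamily f (M / 2 + 1) ((M - 1) / 2) i) = 0)
    (hcard : n ≤ M / 2 + (M - 1) / 2 + 2 + Fintype.card κ) :
    IsParityCheckMatrix (matH P γ F M) C := by
  have hrow : ∀ i m, (matH P γ F M).row i m =
      γ m / (a * (P m).x + b) * evalPair P (checkFamily f (M / 2 + 1) ((M - 1) / 2) i) m := by
    intro i m
    rcases i with i | i | i
    · change γ m / (a * (P m).x + b) * F (P m).x (P m).y = _
      rw [hF]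
      rfl
    · change γ m * (P m).x ^ (i : ℕ) / (a * (P m).x + b) = _
      simp [checkFamily, evalPair_apply, div_mul_eq_mul_div]
    · change γ m * (P m).y * (P m).x ^ (i : ℕ) = _
      have := (P m).ne_zero
      simp only [checkFamily, evalPair_apply, Sum.elim_inr, eval_zero, eval_pow, eval_X]
      field_simp
      ring
  refine isParityCheckMatrix_of_card_le ?_ ?_ hv
    (fun j => by rw [hC]; exact Submodule.subset_span ⟨j, rfl⟩) ?_
  · let D : (Fin n → K) →ₗ[K] (Fin n → K) :=
      LinearMap.pi fun m => (γ m / (a * (P m).x + b)) • LinearMap.proj m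
    have hD : LinearMap.ker D = ⊥ := by
      rw [LinearMap.ker_eq_bot']
      intro z hz
      ext m
      have := congrFun hz m
      simpa [D, h.residue_ne_zero m, (P m).ne_zero] using this
    have : (matH P γ F M).row =
        D ∘ fun i => evalPair P (checkFamily f (M / 2 + 1) ((M - 1) / 2) i) := by
      ext i m
      rw [hrow]
      simp [D]
    rw [this]
    exact hf.map' D hD
  · intro i c hc
    rw [hC] at hc
    induction hc using Submodule.span_induction with
    | mem c hc =>
      obtain ⟨j, rfl⟩ := hc
      simp only [hrow]
      rw [h.sum_evalPair_mul, hp]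
    | zero => simp
    | add c c' _ _ hc hc' =>
      simp only [Pi.add_apply, add_mul, Finset.sum_add_distrib, hc, hc', add_zero]
    | smul r c _ hc =>
      simp only [Pi.smul_apply, smul_eq_mul, mul_assoc, ← Finset.mul_sum, hc, mul_zero]
  · simp only [Fintype.card_sum, Fintype.card_unit, Fintype.card_fin]
    omega

end IsConjugatePairs

/-! ### Spanning sets of the twisted codes -/

section Codes

variable [CharP K 2] {a b : K} {n : ℕ} (P : Fin n → Pt a b)

theorem ev_xF_pow (i : ℕ) : ev P (xF a b ^ i) = evalPair P (X ^ i, 0) := by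
  ext m
  simp [ev, evalPair_apply, evalAt_xF_pow]

theorem ev_xF_pow_mul (j : ℕ) :
    ev P (xF a b ^ j * wF a b * yF a b) = evalPair P (0, X ^ j) := by
  ext m
  simp [ev, evalPair_apply, evalAt_xF_pow_mul]

/-- The functions that span the defining set for odd `k`, as pairs of polynomials. -/
def oddFamily (k l : ℕ) (η : K) :
    Fin ((k - 1) / 2 + 1) ⊕ Fin ((k - 3) / 2 + 1) → K[X] × K[X] :=
  Sum.elim (fun i => (X ^ (i : ℕ), 0))
    (fun j => (if (j : ℕ) = l then η • X ^ ((k + 1) / 2) else 0, X ^ (j : ℕ)))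

/-- The functions that span the defining set for even `k`, as pairs of polynomials. -/
def evenFamily (k l : ℕ) (η : K) :
    Fin (k / 2 + 1) ⊕ Fin ((k - 4) / 2 + 1) → K[X] × K[X] :=
  Sum.elim (fun i => (X ^ (i : ℕ), if (i : ℕ) = l then η • X ^ ((k - 2) / 2) else 0))
    (fun j => (0, X ^ (j : ℕ)))

/-- The twist shares its coefficient with the generator of index `l`, so it is attached to that
generator; `hl` makes `l` a valid index. -/
theorem oddCode_eq_span {k l : ℕ} (hl : l ≤ (k - 3) / 2) (η : K) :
    oddCode P k l η = Submodule.span K (Set.range fun i => evalPair P (oddFamily k l η i)) := by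
  have key : ∀ A B : ℕ → K,
      ev P (∑ i ∈ Finset.range ((k - 1) / 2 + 1), A i • xF a b ^ i
      + ∑ j ∈ Finset.range ((k - 3) / 2 + 1), B j • (xF a b ^ j * wF a b * yF a b)
      + (B l * η) • xF a b ^ ((k + 1) / 2)) =
      ∑ i : Fin ((k - 1) / 2 + 1), A i • evalPair P (oddFamily k l η (Sum.inl i)) +
      ∑ j : Fin ((k - 3) / 2 + 1), B j • evalPair P (oddFamily k l η (Sum.inr j)) := by
    intro A B
    simp only [map_add, map_sum, map_smul, ev_xF_pow, ev_xF_pow_mul, oddFamily, Sum.elim_inl,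
      Sum.elim_inr]
    rw [Finset.sum_range, Finset.sum_range, add_assoc]
    congr 1
    simp only [← map_smul, ← map_sum, ← map_add]
    congr 1
    have hs : ∑ j : Fin ((k - 3) / 2 + 1),
        B j • (if (j : ℕ) = l then η • (X : K[X]) ^ ((k + 1) / 2) else 0) =
        (B l * η) • X ^ ((k + 1) / 2) := by
      rw [Finset.sum_eq_single ⟨l, by omega⟩]
      · simp [mul_smul]
      · intro j _ hj
        rw [if_neg (fun e => hj (Fin.ext e)), smul_zero]
      · simp
    ext1
    · simpa [Prod.fst_sum] using hs.symm
    · simp [Prod.snd_sum]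
  apply le_antisymm
  · rintro _ ⟨_, ⟨A, B, rfl⟩, rfl⟩
    rw [key]
    exact Submodule.add_mem _
      (Submodule.sum_mem _ fun i _ => Submodule.smul_mem _ _ (Submodule.subset_span ⟨_, rfl⟩))
      (Submodule.sum_mem _ fun i _ => Submodule.smul_mem _ _ (Submodule.subset_span ⟨_, rfl⟩))
  · rw [Submodule.span_le]
    rintro _ ⟨i | j, rfl⟩
    · refine ⟨_, ⟨Pi.single (i : ℕ) 1, 0, rfl⟩, ?_⟩
      rw [key]
      simp [Pi.single_apply, Fin.val_inj]
    · refine ⟨_, ⟨0, Pi.single (j : ℕ) 1, rfl⟩, ?_⟩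
      rw [key]
      simp [Pi.single_apply, Fin.val_inj]

theorem evenCode_eq_span {k l : ℕ} (hl : l ≤ k / 2) (η : K) :
    evenCode P k l η =
      Submodule.span K (Set.range fun i => evalPair P (evenFamily k l η i)) := by
  have key : ∀ A B : ℕ → K,
      ev P (∑ i ∈ Finset.range (k / 2 + 1), A i • xF a b ^ i
      + ∑ j ∈ Finset.range ((k - 4) / 2 + 1), B j • (xF a b ^ j * wF a b * yF a b)
      + (A l * η) • (xF a b ^ ((k - 2) / 2) * wF a b * yF a b)) =
      ∑ i : Fin (k / 2 + 1), A i • evalPair P (evenFamily k l η (Sum.inl i)) +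
      ∑ j : Fin ((k - 4) / 2 + 1), B j • evalPair P (evenFamily k l η (Sum.inr j)) := by
    intro A B
    simp only [map_add, map_sum, map_smul, ev_xF_pow, ev_xF_pow_mul, evenFamily, Sum.elim_inl,
      Sum.elim_inr]
    rw [Finset.sum_range, Finset.sum_range, add_right_comm]
    congr 1
    simp only [← map_smul, ← map_sum, ← map_add]
    congr 1
    have hs : ∑ j : Fin (k / 2 + 1),
        A j • (if (j : ℕ) = l then η • (X : K[X]) ^ ((k - 2) / 2) else 0) =
        (A l * η) • X ^ ((k - 2) / 2) := by
      rw [Finset.sum_eq_single ⟨l, by omega⟩]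
      · simp [mul_smul]
      · intro j _ hj
        rw [if_neg (fun e => hj (Fin.ext e)), smul_zero]
      · simp
    ext1
    · simp [Prod.fst_sum]
    · simpa [Prod.snd_sum] using hs.symm
  apply le_antisymm
  · rintro _ ⟨_, ⟨A, B, rfl⟩, rfl⟩
    rw [key]
    exact Submodule.add_mem _
      (Submodule.sum_mem _ fun i _ => Submodule.smul_mem _ _ (Submodule.subset_span ⟨_, rfl⟩))
      (Submodule.sum_mem _ fun i _ => Submodule.smul_mem _ _ (Submodule.subset_span ⟨_, rfl⟩))
  · rw [Submodule.span_le]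
    rintro _ ⟨i | j, rfl⟩
    · refine ⟨_, ⟨Pi.single (i : ℕ) 1, 0, rfl⟩, ?_⟩
      rw [key]
      simp [Pi.single_apply, Fin.val_inj]
    · refine ⟨_, ⟨0, Pi.single (j : ℕ) 1, rfl⟩, ?_⟩
      rw [key]
      simp [Pi.single_apply, Fin.val_inj]

end Codes

/-! ### Pairings with sums of monomials -/

/-- The polynomial `∑_{i ≤ N} c_i X ^ (D - i)`. -/
def descPoly (c : ℕ → K) (N D : ℕ) : K[X] := ∑ i ∈ Finset.range (N + 1), c i • X ^ (D - i)

theorem descPoly_mem_degreeLT (c : ℕ → K) (N : ℕ) {D d : ℕ} (h : D < d) :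
    descPoly c N D ∈ degreeLT K d :=
  Submodule.sum_mem _ fun i _ => Submodule.smul_mem _ _ (X_pow_mem_degreeLT (by omega))

theorem coeff_descPoly (c : ℕ → K) {N D : ℕ} (h : N ≤ D) : (descPoly c N D).coeff D = c 0 := by
  simp only [descPoly, finsetSum_coeff, coeff_smul, coeff_X_pow]
  rw [Finset.sum_eq_single 0]
  · simp
  · intro i hi hi0
    rw [Finset.mem_range] at hi
    rw [if_neg (by omega), smul_zero]
  · simp

theorem eval_descPoly (c : ℕ → K) (N D : ℕ) (x : K) :
    eval x (descPoly c N D) = ∑ i ∈ Finset.range (N + 1), c i * x ^ (D - i) := by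
  simp [descPoly, eval_finsetSum]

theorem weightSum_X_pow_mul_descPoly (T : Finset K) (e : ℕ) (c : ℕ → K) (N D : ℕ) :
    weightSum T (X ^ e * descPoly c N D) =
      ∑ i ∈ Finset.range (N + 1), c i * weightSum T (X ^ (e + (D - i))) := by
  simp [descPoly, Finset.mul_sum, map_sum, pow_add]

theorem weightSum_X_pow_mul_descPoly_mul_wPoly (a b : K) (T : Finset K) (e : ℕ) (c : ℕ → K)
    (N D : ℕ) :
    weightSum T (X ^ e * descPoly c N D * wPoly a b) =
      ∑ i ∈ Finset.range (N + 1), c i * weightSum T (X ^ (e + (D - i)) * wPoly a b) := by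
  simp [descPoly, Finset.mul_sum, Finset.sum_mul, map_sum, pow_add]

theorem pairing_X_pow_zero (a b : K) (T : Finset K) (i : ℕ) (v : K[X] × K[X]) :
    pairing a b T (X ^ i, 0) v = weightSum T (X ^ i * v.2) := by
  simp [pairing]

theorem pairing_X_pow_smul (a b : K) (T : Finset K) (i j : ℕ) (η : K) (v : K[X] × K[X]) :
    pairing a b T (X ^ i, η • X ^ j) v = weightSum T (X ^ i * v.2) +
      η * (weightSum T (X ^ j * v.1) + weightSum T (X ^ j * v.2 * wPoly a b)) := by
  simp [pairing, mul_add, add_assoc]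

theorem pairing_smul_X_pow (a b : K) (T : Finset K) (i j : ℕ) (η : K) (v : K[X] × K[X]) :
    pairing a b T (η • X ^ i, X ^ j) v = η * weightSum T (X ^ i * v.2) +
      (weightSum T (X ^ j * v.1) + weightSum T (X ^ j * v.2 * wPoly a b)) := by
  simp [pairing, add_assoc]

theorem pairing_zero_X_pow (a b : K) (T : Finset K) (j : ℕ) (v : K[X] × K[X]) :
    pairing a b T (0, X ^ j) v =
      weightSum T (X ^ j * v.1) + weightSum T (X ^ j * v.2 * wPoly a b) := by
  simp [pairing]

theorem sum_range_eq_of_forall_eq_zero {f : ℕ → K} {m m' : ℕ} (h : m' ≤ m)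
    (hf : ∀ i, m' ≤ i → i < m → f i = 0) :
    ∑ i ∈ Finset.range m, f i = ∑ i ∈ Finset.range m', f i := by
  symm
  refine Finset.sum_subset (Finset.range_mono h) fun i hi hi' => hf i ?_ (Finset.mem_range.1 hi)
  simpa using hi'

/-- `∑_i c_i weightSum (X ^ E i)` for exponents that decrease from `card T + r - 1`. -/
theorem sum_mul_weightSum_eq {T : Finset K} (hT : 2 ≤ T.card) (c : ℕ → K) {N r : ℕ}
    (hr : r ≤ N) {E : ℕ → ℕ} (hE : ∀ i ≤ N, E i + i = T.card - 1 + r) :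
    ∑ i ∈ Finset.range (N + 1), c i * weightSum T (X ^ E i) =
      ∑ i ∈ Finset.range r, c i * weightSum T (X ^ (T.card + r - 1 - i)) + c r := by
  rw [sum_range_eq_of_forall_eq_zero (m' := r + 1) (by omega), Finset.sum_range_succ]
  · have h := hE r hr
    rw [show E r = T.card - 1 by omega, weightSum_X_pow_card_sub_one (by omega), mul_one]
    congr 1
    refine Finset.sum_congr rfl fun i hi => ?_
    rw [Finset.mem_range] at hi
    have h := hE i (by omega)
    rw [show E i = T.card + r - 1 - i by omega]
  · intro i hi hi'
    have h := hE i (by omega)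
    rw [weightSum_X_pow_of_lt (by omega), mul_zero]

/-- The factor `w` raises degrees by one, so vanishing begins at exponent `card T - 3`, reached at
index `r`. Unlike in `sum_mul_weightSum_eq`, no diagonal term `c r` remains. -/
theorem sum_mul_weightSum_wPoly_eq (a b : K) {T : Finset K} (hT : 3 ≤ T.card) (c : ℕ → K)
    {N r : ℕ} (hr : r ≤ N + 1) {E : ℕ → ℕ} (hE : ∀ i ≤ N, E i + i = T.card - 3 + r) :
    ∑ i ∈ Finset.range (N + 1), c i * weightSum T (X ^ E i * wPoly a b) =
      ∑ i ∈ Finset.range r, c i * weightSum T (X ^ (T.card + r - 3 - i) * wPoly a b) := by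
  rw [sum_range_eq_of_forall_eq_zero (m' := r) (by omega)]
  · refine Finset.sum_congr rfl fun i hi => ?_
    rw [Finset.mem_range] at hi
    have h := hE i (by omega)
    rw [show E i = T.card + r - 3 - i by omega]
  · intro i hi hi'
    have h := hE i (by omega)
    rw [weightSum_X_pow_mul_wPoly_of_lt a b (by omega), mul_zero]

theorem sum_mul_weightSum_eq_zero {T : Finset K} (c : ℕ → K) {N : ℕ} {E : ℕ → ℕ}
    (hE : ∀ i ≤ N, E i < T.card - 1) :
    ∑ i ∈ Finset.range (N + 1), c i * weightSum T (X ^ E i) = 0 :=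
  Finset.sum_eq_zero fun i hi => by
    rw [weightSum_X_pow_of_lt (hE i (by simpa [Nat.lt_succ_iff] using hi)), mul_zero]

theorem sum_mul_weightSum_wPoly_eq_zero (a b : K) {T : Finset K} (c : ℕ → K) {N : ℕ}
    {E : ℕ → ℕ} (hE : ∀ i ≤ N, E i + 1 < T.card - 1) :
    ∑ i ∈ Finset.range (N + 1), c i * weightSum T (X ^ E i * wPoly a b) = 0 :=
  Finset.sum_eq_zero fun i hi => by
    rw [weightSum_X_pow_mul_wPoly_of_lt a b (hE i (by simpa [Nat.lt_succ_iff] using hi)),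
      mul_zero]

namespace IsConjugatePairs

variable {a b : K} {n : ℕ} {P : Fin n → Pt a b} {γ : Fin n → K} {T : Finset K} {y : K → K}
  [CharP K 2]

theorem sumB_card_sub_one (h : IsConjugatePairs P γ T y) (hT : 0 < T.card) :
    sumB P γ (T.card - 1) = 1 := by
  rw [h.sumB_eq, weightSum_X_pow_card_sub_one hT]

/-! ### Odd `k` -/

/-- Since all `A_e` vanish, the steps for `d` are homogeneous and give `d_j = 0` for `j < N`. The
recursion for `c` then involves only `B`, and the last equation reduces to `d_N = -1 / η`. -/
theorem exists_oddRec (h : IsConjugatePairs P γ T y) (hT : 0 < T.card) (k l : ℕ) (η : K) :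
    ∃ c d : ℕ → K, OddRec P γ T.card k l η c d := by
  obtain ⟨c, hc⟩ := exists_linear_recursion (fun r => if r = 0 then (1 : K) else 0)
    (fun r i => -sumB P γ (T.card + r - 1 - i))
  refine ⟨c, fun j => if j < (k - 3) / 2 - l then 0 else -(1 / η), ?_, ?_, ?_, ?_⟩
  · simp [hc 0]
  · intro r hr hr'
    rw [if_pos (by omega), Finset.sum_eq_zero, Finset.sum_eq_zero]
    · simp
    · intro j hj
      rw [Finset.mem_range] at hj
      rw [if_pos (by omega), zero_mul]
    · simp [h.sumA_eq_zero]
  · intro r hr hr'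
    rw [hc r, if_neg (by omega), h.sumB_card_sub_one hT, div_one, zero_add,
      Finset.sum_eq_zero (f := fun j => (if j < (k - 3) / 2 - l then (0 : K) else -(1 / η)) * _)]
    · simp
    · intro j hj
      rw [Finset.mem_range] at hj
      rw [if_pos (by omega), zero_mul]
  · rw [if_neg (by omega), h.sumB_card_sub_one hT,
      Finset.sum_eq_zero (f := fun j => (if j < (k - 3) / 2 - l then (0 : K) else -(1 / η)) * _)]
    · simp [h.sumA_eq_zero, neg_div]
    · intro j hj
      rw [Finset.mem_range] at hj
      rw [if_pos hj, zero_mul]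

theorem pairing_oddFamily (h : IsConjugatePairs P γ T y) {k l : ℕ} (hk : Odd k) (hk3 : 3 ≤ k)
    (hkT : k ≤ 2 * T.card - 2) (hl : l ≤ (k - 3) / 2) {η : K} (hη : η ≠ 0) {c d : ℕ → K}
    (hr : OddRec P γ T.card k l η c d)
    (j : Fin ((k - 1) / 2 + 1) ⊕ Fin ((k - 3) / 2 + 1)) :
    pairing a b T (oddFamily k l η j)
      (descPoly c ((k - 3) / 2 - l) (T.card - l - 1),
        descPoly d ((k - 3) / 2 - l) (T.card - l - 3)) = 0 := by
  obtain ⟨t, rfl⟩ := hk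
  have h3 : (2 * t + 1 - 3) / 2 = t - 1 := by omega
  have h1 : (2 * t + 1 + 1) / 2 = t + 1 := by omega
  have hB1 := h.sumB_card_sub_one (by omega)
  have hd := hr.d_step
  have hc := hr.c_step
  have hdl := hr.d_last
  have hc0 := hr.c_zero
  simp only [h3, h1, hB1, h.sumA_eq_zero, h.sumB_eq, h.sumC_eq,
    mul_zero, Finset.sum_const_zero, zero_add, div_one, mul_one, add_zero] at hd hc hdl
  rcases j with ⟨i, hi⟩ | ⟨j, hj⟩
  · simp only [h3, oddFamily, Sum.elim_inl, pairing_X_pow_zero,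
      weightSum_X_pow_mul_descPoly]
    -- The largest exponent is `i + s - l - 3`, which reaches `s - 1` only from `i = l + 2` on.
    by_cases hil : i ≤ l + 1
    · exact sum_mul_weightSum_eq_zero d fun j _ => by omega
    · rw [sum_mul_weightSum_eq (r := i - l - 2) (by omega) d (by omega)
        (fun j _ => by omega)]
      -- Step `r` of the recursion defines `d (r - 1)`, so the diagonal term `d (i - l - 2)` comes
      -- from step `i - l - 1`.
      rw [show i - l - 2 = i - l - 1 - 1 by omega, hd (i - l - 1) (by omega) (by omega)]
      rw [← sub_eq_add_neg, sub_eq_zero]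
      refine Finset.sum_congr rfl fun j hj => ?_
      congr 4
      omega
  · simp only [h3, h1, oddFamily, Sum.elim_inr]
    split_ifs with hjl
    · subst hjl
      -- For the twisted generator the untwisted part contributes only `c 0 = 1`, and the twist
      -- contributes `η` times a sum ending in the coefficient `d_N`; `d_last` makes the total zero.
      rw [pairing_smul_X_pow, weightSum_X_pow_mul_descPoly, weightSum_X_pow_mul_descPoly,
        weightSum_X_pow_mul_descPoly_mul_wPoly,
        sum_mul_weightSum_eq (r := t - 1 - j) (by omega) d le_rfl (fun j _ => by omega),
        sum_mul_weightSum_eq (r := 0) (by omega) c (by omega) (fun j _ => by omega),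
        sum_mul_weightSum_wPoly_eq (r := 0) a b (by omega) d (by omega) (fun j _ => by omega),
        hdl, hc0]
      have he : ∑ i ∈ Finset.range (t - 1 - j),
          d i * weightSum T (X ^ (T.card + (t - 1 - j) - 1 - i)) =
          ∑ i ∈ Finset.range (t - 1 - j),
            d i * weightSum T (X ^ (T.card - j - 3 + (t + 1) - i)) := by
        refine Finset.sum_congr rfl fun i hi => ?_
        congr 3
        omega
      rw [he]
      simp only [Finset.range_zero, Finset.sum_empty]
      field_simp
      ring
    · rw [pairing_zero_X_pow, weightSum_X_pow_mul_descPoly, weightSum_X_pow_mul_descPoly_mul_wPoly]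
      by_cases hlt : j < l
      · rw [sum_mul_weightSum_eq_zero c (fun j _ => by omega),
          sum_mul_weightSum_wPoly_eq_zero a b d (fun j _ => by omega), add_zero]
      · rw [sum_mul_weightSum_eq (r := j - l) (by omega) c (by omega) (fun j _ => by omega),
          sum_mul_weightSum_wPoly_eq (r := j - l) a b (by omega) d (by omega)
            (fun j _ => by omega), hc (j - l) (by omega) (by omega)]
        ring

theorem isParityCheckMatrix_odd (h : IsConjugatePairs P γ T y) {k l : ℕ} (hk : Odd k)
    (hk3 : 3 ≤ k) (hkT : k ≤ 2 * T.card - 2) (hl : l ≤ (k - 3) / 2) {η : K} (hη : η ≠ 0)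
    {c d : ℕ → K} (hr : OddRec P γ T.card k l η c d) :
    IsParityCheckMatrix (matH P γ (oddF a b T.card k l c d) (n - k - 1)) (oddCode P k l η) := by
  have hn := h.card_eq
  have hk' := hk
  obtain ⟨t, ht⟩ := hk'
  refine h.isParityCheckMatrix_matH (f := (descPoly c ((k - 3) / 2 - l) (T.card - l - 1),
    descPoly d ((k - 3) / 2 - l) (T.card - l - 3))) ?_ ?_ ?_ (oddCode_eq_span P hl η) ?_ ?_
  · intro m
    simp [oddF, evalPair_apply, eval_descPoly, Finset.sum_mul]
  · refine h.linearIndependent_checkFamily_of_fst (d := T.card - l - 1)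
      (descPoly_mem_degreeLT _ _ (by omega)) ?_ (by omega) (by omega) (by omega)
    rw [coeff_descPoly _ (by omega), hr.c_zero]
    exact one_ne_zero
  · exact h.linearIndependent_add_fst (by omega) (by omega) _
  · rintro (_ | i | j) q
    · exact h.pairing_oddFamily hk hk3 hkT hl hη hr q
    · rcases q with q | q
      · simp [checkFamily, oddFamily, pairing_X_pow_zero]
      · simp only [checkFamily, oddFamily, Sum.elim_inr, Sum.elim_inl]
        split_ifs
        · rw [pairing_smul_X_pow]
          simp only [mul_zero, zero_mul, map_zero, add_zero, zero_add, ← pow_add]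
          exact weightSum_X_pow_of_lt (by omega)
        · rw [pairing_zero_X_pow]
          simp only [mul_zero, zero_mul, map_zero, add_zero, ← pow_add]
          exact weightSum_X_pow_of_lt (by omega)
    · rcases q with q | q
      · simp only [checkFamily, oddFamily, Sum.elim_inr, Sum.elim_inl, pairing_X_pow_zero,
          ← pow_add]
        exact weightSum_X_pow_of_lt (by omega)
      · simp only [checkFamily, oddFamily, Sum.elim_inr]
        split_ifs
        · rw [pairing_smul_X_pow]
          simp only [mul_zero, map_zero, zero_add, ← pow_add]
          rw [weightSum_X_pow_of_lt (by omega), weightSum_X_pow_mul_wPoly_of_lt _ _ (by omega)]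
          simp
        · rw [pairing_zero_X_pow]
          simp only [mul_zero, map_zero, zero_add, ← pow_add]
          exact weightSum_X_pow_mul_wPoly_of_lt _ _ (by omega)
  · simp only [Fintype.card_sum, Fintype.card_fin]
    omega

/-! ### Even `k` -/

/-- Since all `A_e` vanish, the recursion for `h` decouples from `e` and is solved alone; `e` is
then computed from it, with its last value replaced by `z`. -/
theorem exists_evenRec (h : IsConjugatePairs P γ T y) (hT : 0 < T.card) (k l : ℕ) (η : K) :
    ∃ e g : ℕ → K, EvenRec P γ T.card k l η e g := by
  obtain ⟨g, hg⟩ := exists_linear_recursion (fun r => if r = 0 then (1 : K) else 0)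
    (fun r i => -sumB P γ (T.card + r - 1 - i))
  obtain ⟨e, he⟩ := exists_linear_recursion
    (fun r => -∑ j ∈ Finset.range (r + 1), g j * sumC P γ (T.card + (r + 1) - 3 - j))
    (fun r i => -sumB P γ (T.card + (r + 1) - 2 - i))
  set z : K := -(sumB P γ (T.card - 1)
      + η * ∑ i ∈ Finset.range (k / 2 - l), e i * sumB P γ (T.card - l + (k - 2) / 2 - i)
      + η * ∑ j ∈ Finset.range (k / 2 - l + 1), g j * sumC P γ (T.card - l - 1 + (k - 2) / 2 - j))
      / (η * sumB P γ (T.card - 1)) with hz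
  have hsum : ∀ m ≤ k / 2 - l, ∀ F : ℕ → K,
      ∑ i ∈ Finset.range m, (if i < k / 2 - l then e i else z) * F i =
        ∑ i ∈ Finset.range m, e i * F i := by
    intro m hm F
    refine Finset.sum_congr rfl fun i hi => ?_
    rw [Finset.mem_range] at hi
    rw [if_pos (by omega)]
  refine ⟨fun i => if i < k / 2 - l then e i else z, g, ?_, ?_, ?_, ?_⟩
  · simp [hg 0]
  · intro r hr hr'
    obtain ⟨r, rfl⟩ := Nat.exists_eq_add_of_le' hr
    rw [hsum _ (by omega), if_pos (by omega), Nat.add_sub_cancel, h.sumB_card_sub_one hT, he r]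
    simp only [mul_neg, Finset.sum_neg_distrib, div_one]
    ring
  · intro r hr hr'
    rw [hg r, if_neg (by omega), h.sumB_card_sub_one hT]
    simp [h.sumA_eq_zero]
  · rw [hsum _ le_rfl, if_neg (by omega), hz]

theorem pairing_evenFamily (h : IsConjugatePairs P γ T y) {k l : ℕ} (hk : Even k) (hk3 : 3 ≤ k)
    (hkT : k ≤ 2 * T.card - 2) (hl : l ≤ k / 2) {η : K} (hη : η ≠ 0) {e g : ℕ → K}
    (hr : EvenRec P γ T.card k l η e g) (j : Fin (k / 2 + 1) ⊕ Fin ((k - 4) / 2 + 1)) :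
    pairing a b T (evenFamily k l η j)
      (descPoly e (k / 2 - l) (T.card - l), descPoly g (k / 2 - l) (T.card - l - 1)) = 0 := by
  rw [even_iff_exists_two_mul] at hk
  obtain ⟨t, rfl⟩ := hk
  have h0 : 2 * t / 2 = t := by omega
  have h2 : (2 * t - 2) / 2 = t - 1 := by omega
  have hB1 := h.sumB_card_sub_one (by omega)
  have he := hr.e_step
  have hg := hr.h_step
  have hel := hr.e_last
  have hg0 := hr.h_zero
  simp only [h0, h2, hB1,
    h.sumA_eq_zero, h.sumB_eq, h.sumC_eq,
    mul_zero, Finset.sum_const_zero, zero_add, div_one, mul_one] at he hg hel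
  rcases j with ⟨i, hi⟩ | ⟨j, hj⟩
  · simp only [h0, h2, evenFamily, Sum.elim_inl]
    split_ifs with hil
    · subst hil
      rw [pairing_X_pow_smul, weightSum_X_pow_mul_descPoly, weightSum_X_pow_mul_descPoly,
        weightSum_X_pow_mul_descPoly_mul_wPoly,
        sum_mul_weightSum_eq (r := 0) (by omega) g (by omega) (fun j _ => by omega),
        sum_mul_weightSum_eq (r := t - i) (by omega) e le_rfl (fun j _ => by omega),
        hel, hg0]
      have he1 : ∑ j ∈ Finset.range (t - i),
          e j * weightSum T (X ^ (T.card + (t - i) - 1 - j)) =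
          ∑ j ∈ Finset.range (t - i), e j * weightSum T (X ^ (T.card - i + (t - 1) - j)) := by
        refine Finset.sum_congr rfl fun j hj => ?_
        congr 3
        omega
      have he2 : ∑ j ∈ Finset.range (t - i + 1),
          g j * weightSum T (X ^ (t - 1 + (T.card - i - 1 - j)) * wPoly a b) =
          ∑ j ∈ Finset.range (t - i + 1),
            g j * weightSum T (X ^ (T.card - i - 1 + (t - 1) - j) * wPoly a b) := by
        refine Finset.sum_congr rfl fun j hj => ?_
        rw [Finset.mem_range] at hj
        congr 4
        omega
      rw [he1, he2]
      simp only [Finset.range_zero, Finset.sum_empty]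
      field_simp
      ring
    · rw [pairing_X_pow_zero, weightSum_X_pow_mul_descPoly]
      by_cases hlt : i < l
      · exact sum_mul_weightSum_eq_zero g fun j _ => by omega
      · rw [sum_mul_weightSum_eq (r := i - l) (by omega) g (by omega) (fun j _ => by omega),
          hg (i - l) (by omega) (by omega)]
        ring
  · simp only [h0, evenFamily, Sum.elim_inr]
    rw [pairing_zero_X_pow, weightSum_X_pow_mul_descPoly, weightSum_X_pow_mul_descPoly_mul_wPoly]
    -- The leading exponent `s - l` of the first component is one larger than that of the second, so
    -- equations start at `j + 1 = l`. There only `e 0` and one term in `C` survive.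
    by_cases hlt : j + 1 < l
    · rw [sum_mul_weightSum_eq_zero e (fun j _ => by omega),
        sum_mul_weightSum_wPoly_eq_zero a b g (fun j _ => by omega), add_zero]
    · by_cases hle : j + 1 = l
      · rw [sum_mul_weightSum_eq (r := 0) (by omega) e (by omega) (fun j _ => by omega),
          -- Rewriting `0` as `1 - 1` below brings `e 0` into the form in which step `1` of the
          -- recursion defines it.
          sum_mul_weightSum_wPoly_eq (r := 1) a b (by omega) g (by omega)
            (fun j _ => by omega), ← Nat.sub_self 1, he 1 le_rfl (by omega)]
        simp
      · rw [sum_mul_weightSum_eq (r := j + 1 - l) (by omega) e (by omega) (fun j _ => by omega),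
          sum_mul_weightSum_wPoly_eq (r := j + 2 - l) a b (by omega) g (by omega)
            (fun j _ => by omega)]
        have := he (j + 2 - l) (by omega) (by omega)
        rw [show j + 2 - l - 1 = j + 1 - l by omega] at this
        rw [this]
        have he1 : ∑ i ∈ Finset.range (j + 1 - l),
            e i * weightSum T (X ^ (T.card + (j + 1 - l) - 1 - i)) =
            ∑ i ∈ Finset.range (j + 1 - l),
              e i * weightSum T (X ^ (T.card + (j + 2 - l) - 2 - i)) := by
          refine Finset.sum_congr rfl fun i hi => ?_
          congr 3
          omega
        rw [he1]
        ring

theorem isParityCheckMatrix_even (h : IsConjugatePairs P γ T y) {k l : ℕ} (hk : Even k)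
    (hk3 : 3 ≤ k) (hkT : k ≤ 2 * T.card - 2) (hl : l ≤ k / 2) {η : K} (hη : η ≠ 0)
    {e g : ℕ → K} (hr : EvenRec P γ T.card k l η e g) :
    IsParityCheckMatrix (matH P γ (evenF a b T.card k l e g) (n - k - 1))
      (evenCode P k l η) := by
  have hn := h.card_eq
  have hk' := hk
  rw [even_iff_exists_two_mul] at hk'
  obtain ⟨t, ht⟩ := hk'
  refine h.isParityCheckMatrix_matH (f := (descPoly e (k / 2 - l) (T.card - l),
    descPoly g (k / 2 - l) (T.card - l - 1))) ?_ ?_ ?_ (evenCode_eq_span P hl η) ?_ ?_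
  · intro m
    simp [evenF, evalPair_apply, eval_descPoly, Finset.sum_mul, add_comm]
  -- The second component is used, with leading coefficient `h_0 = 1`; the first may have degree `s`
  -- when `l = 0`, too large for the vanishing test on `T`.
  · refine h.linearIndependent_checkFamily_of_snd (d := T.card - l - 1)
      (descPoly_mem_degreeLT _ _ (by omega)) ?_ (by omega) (by omega) (by omega)
    rw [coeff_descPoly _ (by omega), hr.h_zero]
    exact one_ne_zero
  · exact h.linearIndependent_add_snd (by omega) (by omega) _
  · rintro (_ | i | j) q
    · exact h.pairing_evenFamily hk hk3 hkT hl hη hr q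
    · rcases q with q | q
      · simp only [checkFamily, evenFamily, Sum.elim_inr, Sum.elim_inl]
        split_ifs
        · rw [pairing_X_pow_smul]
          simp only [mul_zero, zero_mul, map_zero, add_zero, zero_add, ← pow_add]
          rw [weightSum_X_pow_of_lt (by omega), mul_zero]
        · simp [pairing_X_pow_zero]
      · simp only [checkFamily, evenFamily, Sum.elim_inr, Sum.elim_inl, pairing_zero_X_pow,
          mul_zero, zero_mul, map_zero, add_zero, ← pow_add]
        exact weightSum_X_pow_of_lt (by omega)
    · rcases q with q | q
      · simp only [checkFamily, evenFamily, Sum.elim_inr, Sum.elim_inl]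
        split_ifs
        · rw [pairing_X_pow_smul]
          simp only [mul_zero, map_zero, zero_add, ← pow_add]
          rw [weightSum_X_pow_of_lt (by omega), weightSum_X_pow_mul_wPoly_of_lt _ _ (by omega)]
          simp
        · simp only [pairing_X_pow_zero, ← pow_add]
          exact weightSum_X_pow_of_lt (by omega)
      · simp only [checkFamily, evenFamily, Sum.elim_inr, pairing_zero_X_pow, mul_zero, map_zero,
          zero_add, ← pow_add]
        exact weightSum_X_pow_mul_wPoly_of_lt _ _ (by omega)
  · simp only [Fintype.card_sum, Fintype.card_fin]
    omega

end IsConjugatePairs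

end TECC

end

theorem mainTheorem7 {K : Type*} [Field K] [Fintype K] [CharP K 2]
    (a b : K) (ha : a ≠ 0)
    (T : Finset K) (hT : ∀ α ∈ T, ∃ P : TECC.Pt a b, P.x = α)
    (n s : ℕ) (hn : n = 2 * s)
    (P : Fin n → TECC.Pt a b) (hP : Function.Injective P)
    (hD : ∀ Q : TECC.Pt a b, (∃ i, P i = Q) ↔ Q.x ∈ T)
    (γ : Fin n → K) (hγ : ∀ i, γ i = TECC.residue (P i) (TECC.invT a b T))
    (k : ℕ) (hk : 3 ≤ k) (hkn : k ≤ n - 2)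
    (η : K) (hη : η ≠ 0) :
    (∀ e, TECC.sumA P γ e = 0) ∧ TECC.sumB P γ (s - 1) ≠ 0 ∧
    (Odd k → ∀ l ≤ (k - 3) / 2,
      (∃ c d : ℕ → K, TECC.OddRec P γ s k l η c d) ∧
      ∀ c d : ℕ → K, TECC.OddRec P γ s k l η c d →
        TECC.IsParityCheckMatrix (TECC.matH P γ (TECC.oddF a b s k l c d) (n - k - 1))
          (TECC.oddCode P k l η)) ∧
    (Even k → ∀ l ≤ k / 2,
      (∃ e h : ℕ → K, TECC.EvenRec P γ s k l η e h) ∧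
      ∀ e h : ℕ → K, TECC.EvenRec P γ s k l η e h →
        TECC.IsParityCheckMatrix (TECC.matH P γ (TECC.evenF a b s k l e h) (n - k - 1))
          (TECC.evenCode P k l η)) := by
  obtain ⟨y, h⟩ := TECC.exists_isConjugatePairs hT hP hD hγ
  have hcard := h.card_eq
  -- Two points lie over each element of `T`, so `n = 2 * T.card`.
  obtain rfl : s = T.card := by omega
  refine ⟨h.sumA_eq_zero, ?_, fun hk' l hl => ⟨h.exists_oddRec (by omega) k l η,
    fun c d hr => h.isParityCheckMatrix_odd hk' hk (by omega) hl hη hr⟩,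
    fun hk' l hl => ⟨h.exists_evenRec (by omega) k l η,
    fun e g hr => h.isParityCheckMatrix_even hk' hk (by omega) hl hη hr⟩⟩
  rw [h.sumB_card_sub_one (by omega)]
  exact one_ne_zero
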